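/- **Setting.** Let $p\in(1,\infty)$. Let $(X,d)$ be a locally compact, separable, complete metric space with at least two points, $m$ a Radon measure on $X$ with full support, $B(x,r)=\{y: d(x,y)<r\}$. Let $\mathcal F_p\subset L^p(X,m)$ be a linear subspace, $\mathcal E_p:\mathcal F_p\to[0,\infty)$ a functional such that $\mathcal E_p^{1/p}$ is a seminorm, and $\{\Gamma_p\langle u\rangle\}_{u\in\mathcal F_p}$ finite Borel measures on $X$ such that: 1. for every $1$-Lipschitz $\varphi:\mathbb R\to\mathbb R$ with $\varphi(0)=0$ and every $u\in\mathcal F_p$, $\varphi(u)\in\mathcal F_p$ and $\mathcal E_p(\varphi(u))\le\mathcal E_p(u)$; and $\mathcal E_p(u)=0$ implies that $u$ is $m$-a.e. constant; 2. $\mathcal F_p$ with the norm $\|u\|_{L^p}+\mathcal E_p(u)^{1/p}$ is a reflexive Banach space; 3. $\mathcal F_p\cap C_c(X)$ is dense in $\mathcal F_p$ for this norm and in $C_c(X)$ for the uniform norm; 4. for every Borel set $E$, $u\mapsto\Gamma_p\langle u\rangle(E)^{1/p}$ is a seminorm on $\mathcal F_p$; 5. $\mathcal E_p(u)=\Gamma_p\langle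 u\rangle(X)$ for all $u\in\mathcal F_p$; 6. if $u,v\in\mathcal F_p\cap C_c(X)$ and $u-v$ is constant on an open set $V$, then $\Gamma_p\langle u\rangle|_V=\Gamma_p\langle v\rangle|_V$. For a non-empty open set $V\subset X$, $\mathcal F_{p,\mathrm{loc}}(V)$ is the set of $m$-classes $u$ of real Borel functions on $V$ such that for each open set $A$ whose closure is compact and contained in $V$ there is $u^\#\in\mathcal F_p$ with $u=u^\#$ $m$-a.e. on $A$. For such $u$, $\Gamma_p\langle u\rangle(E)$ ($E\subset V$ Borel) denotes the increasing limit of $\Gamma_p\langle u^\#\rangle(E\cap A)$ as $A$ increases to $V$. Let $\Psi:(0,\infty)\to(0,\infty)$ be a continuous increasing bijection such that, for some constants $C_\Psi\ge1$, $\beta_1,\beta_2>0$, $$C_\Psi^{-1}(R/r)^{\beta_1}\le\Psi(R)/\Psi(r)\le C_\Psi(R/r)^{\beta_2}\qquad(0<r\le R).$$ For $0<m(S)<\infty$ write $u_S=\frac1{m(S)}\int_S u\,dm$. **Theorem.** Assume that, with constants $c_{\mathrm D}\ge1$, $C_{\mathrm P}>0$, $A_{\mathrm P}\ge1$, for all $x\in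 X$ and $r>0$, $$m(B(x,2r))\le c_{\mathrm D}\,m(B(x,r))\tag{VD}$$ and, for all $u\in\mathcal F_p$, $$\int_{B(x,r)}|u-u_{B(x,r)}|^p\,dm\le C_{\mathrm P}\Psi(r)\,\Gamma_p\langle u\rangle(B(x,A_{\mathrm P}r)).\tag{PI$_p(\Psi)$}$$ Let $A\ge1$ and let $U\subsetneq X$ be an $A$-uniform domain: a non-empty connected open set such that any $x,y\in U$ are joined by a curve $\gamma$ in $U$ with $\operatorname{diam}\gamma\le A\,d(x,y)$ and $d(z,X\setminus U)\ge A^{-1}\min\{d(x,z),d(y,z)\}$ for all $z\in\gamma$. Write $B_U(x,r)=B(x,r)\cap U$. Then there are constants $A_U,C_U\ge1$, depending only on $p,c_{\mathrm D},A,C_\Psi,\beta_2,C_{\mathrm P},A_{\mathrm P}$, such that for all $x\in U$, all $r>0$ and all $u\in\mathcal F_{p,\mathrm{loc}}(B_U(x,A_Ur))$, $$\int_{B_U(x,r)}|u-u_{B_U(x,r)}|^p\,dm\le C_U\,\Psi(r)\,\Gamma_p\langle u\rangle(B_U(x,A_Ur)).$$ Here, if the right-hand side is finite, then $u\in L^p(B_U(x,r),m)$,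 so that the left-hand side is meaningful; if the right-hand side is infinite, nothing is claimed. -/

import Mathlib

open MeasureTheory Set Filter Topology
open scoped ENNReal NNReal

/-- `E` is a `p`-energy form on the space `V`: it is nonnegative and `E ^ (1 / p)` is a seminorm. -/
structure IsPEnergyForm {V : Type*} [AddCommGroup V] [Module ℝ V] (p : ℝ) (E : V → ℝ) : Prop where
  nonneg : ∀ u, 0 ≤ E u
  add_le : ∀ u v, E (u + v) ^ (1 / p) ≤ E u ^ (1 / p) + E v ^ (1 / p)
  smul_eq : ∀ (c : ℝ) (u : V), E (c • u) ^ (1 / p) = |c| * E u ^ (1 / p)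

/-- The function `N` is a norm on the real vector space `V`, and `V` with this norm is a reflexive
Banach space: it is complete and the canonical map into its bidual is onto. -/
def IsReflexiveBanachNorm {V : Type*} [AddCommGroup V] [Module ℝ V] (N : V → ℝ) : Prop :=
  letI : Norm V := ⟨N⟩
  ∃ core : NormedSpace.Core ℝ V,
    letI : NormedAddCommGroup V := NormedAddCommGroup.ofCore core
    letI : NormedSpace ℝ V := NormedSpace.ofCore core
    CompleteSpace V ∧ Function.Surjective (NormedSpace.inclusionInDoubleDual ℝ V)

/-- `f` is a continuous, compactly supported representative of the class `u`. -/
def IsCcRep {X : Type*} [TopologicalSpace X] [MeasurableSpace X] {m : Measure X}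
    (u : X →ₘ[m] ℝ) (f : X → ℝ) : Prop :=
  Continuous f ∧ HasCompactSupport f ∧ u =ᵐ[m] f

/-- A `p`-energy form `(energy, domain)` on `(X, m)`, together with a family `Γ` of `p`-energy
measures. -/
structure PEnergyStructure (X : Type*) [MetricSpace X] [MeasurableSpace X] [BorelSpace X]
    (m : Measure X) (p : ℝ) where
  /-- The domain of the form: a linear space of classes of measurable functions. -/
  domain : Submodule ℝ (X →ₘ[m] ℝ)
  /-- The `p`-energy. -/
  energy : domain → ℝ
  /-- The `p`-energy measures. -/
  Γ : domain → Measure X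
  energy_form : IsPEnergyForm p energy
  memLp : ∀ u : domain, MemLp (u : X →ₘ[m] ℝ) (ENNReal.ofReal p) m
  finite_Γ : ∀ u : domain, IsFiniteMeasure (Γ u)
  /-- Lipschitz contraction property. The normalisation `φ 0 = 0` keeps `φ ∘ u` in `L ^ p` when `m`
  has infinite mass. -/
  lipschitz_contraction : ∀ (φ : ℝ → ℝ) (hφ : LipschitzWith 1 φ), φ 0 = 0 → ∀ u : domain,
    ∃ h : AEEqFun.comp φ hφ.continuous (u : X →ₘ[m] ℝ) ∈ domain, energy ⟨_, h⟩ ≤ energy u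
  /-- Only constants have zero energy. -/
  eq_const_of_energy_eq_zero : ∀ u : domain, energy u = 0 →
    ∃ c : ℝ, (u : X →ₘ[m] ℝ) =ᵐ[m] fun _ => c
  reflexive : IsReflexiveBanachNorm fun u : domain =>
    (eLpNorm (u : X →ₘ[m] ℝ) (ENNReal.ofReal p) m).toReal + energy u ^ (1 / p)
  /-- Regularity: `domain ∩ C_c(X)` is dense in `domain`. -/
  dense_domain : ∀ (u : domain) (ε : ℝ), 0 < ε → ∃ v : domain,
    (∃ f : X → ℝ, IsCcRep (v : X →ₘ[m] ℝ) f) ∧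
      (eLpNorm ((u - v : domain) : X →ₘ[m] ℝ) (ENNReal.ofReal p) m).toReal
        + energy (u - v) ^ (1 / p) < ε
  /-- Regularity: `domain ∩ C_c(X)` is uniformly dense in `C_c(X)`. -/
  dense_Cc : ∀ g : X → ℝ, Continuous g → HasCompactSupport g → ∀ ε : ℝ, 0 < ε →
    ∃ (v : domain) (f : X → ℝ), IsCcRep (v : X →ₘ[m] ℝ) f ∧ ∀ x, |g x - f x| < ε
  Γ_form : ∀ A : Set X, MeasurableSet A → IsPEnergyForm p fun u : domain => (Γ u A).toReal
  energy_eq : ∀ u : domain, energy u = (Γ u univ).toReal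
  /-- Strong locality of the energy measures. -/
  strongly_local : ∀ (u v : domain) (f g : X → ℝ), IsCcRep (u : X →ₘ[m] ℝ) f →
    IsCcRep (v : X →ₘ[m] ℝ) g → ∀ U : Set X, IsOpen U → (∃ c : ℝ, ∀ x ∈ U, f x - g x = c) →
      (Γ u).restrict U = (Γ v).restrict U

/-- `A` is a relatively compact open subset of the open set `V`: the closure of `A` is compact and
contained in `V`. -/
def IsRelCompactOpenIn {X : Type*} [TopologicalSpace X] (A V : Set X) : Prop :=
  IsOpen A ∧ IsCompact (closure A) ∧ closure A ⊆ V

namespace PEnergyStructure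

variable {X : Type*} [MetricSpace X] [MeasurableSpace X] [BorelSpace X] {m : Measure X} {p : ℝ}

/-- The local space `F_{p,loc}(V)`: the class `u` of functions on `V` agrees a.e. on each relatively
compact open subset of `V` with a member of the domain. -/
def MemLoc (D : PEnergyStructure X m p) (V : Set X) (u : X →ₘ[m.restrict V] ℝ) : Prop :=
  ∀ A : Set X, IsRelCompactOpenIn A V → ∃ w : D.domain, (w : X →ₘ[m] ℝ) =ᵐ[m.restrict A] u

/-- The energy measure `Γ_{p,V}⟨u⟩` of `u ∈ F_{p,loc}(V)`, evaluated at a Borel set `E`. It is the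
increasing limit of `Γ ⟨w⟩ (E ∩ A)`, where `A` runs through the relatively compact open subsets of
`V` and `w` is a member of the domain with `w = u` a.e. on `A`. By strong locality `Γ ⟨w⟩ (E ∩ A)`
does not depend on the choice of `w`, and it is monotone in `A`, so the limit along an exhaustion
of `V` is the supremum. -/
noncomputable def localEnergy (D : PEnergyStructure X m p) (V : Set X)
    (u : X →ₘ[m.restrict V] ℝ) (E : Set X) : ℝ≥0∞ :=
  ⨆ (A : Set X) (_ : IsRelCompactOpenIn A V) (w : D.domain)
    (_ : (w : X →ₘ[m] ℝ) =ᵐ[m.restrict A] u), D.Γ w (E ∩ A)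

/-- The `(p,p)`-Poincaré inequality with scale function `Ψ` and constants `C`, `A`. -/
def Poincare (D : PEnergyStructure X m p) (Ψ : ℝ → ℝ) (C A : ℝ) : Prop :=
  ∀ (x : X) (r : ℝ), 0 < r → ∀ u : D.domain,
    ∫⁻ y in Metric.ball x r, ENNReal.ofReal
        (|(u : X →ₘ[m] ℝ) y - ⨍ z in Metric.ball x r, (u : X →ₘ[m] ℝ) z ∂m| ^ p) ∂m
      ≤ ENNReal.ofReal (C * Ψ r) * D.Γ u (Metric.ball x (A * r))

end PEnergyStructure

/-- Volume doubling with constant `c`. -/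
def VolumeDoubling {X : Type*} [MetricSpace X] [MeasurableSpace X] (m : Measure X) (c : ℝ) : Prop :=
  ∀ (x : X) (r : ℝ), 0 < r →
    m (Metric.ball x (2 * r)) ≤ ENNReal.ofReal c * m (Metric.ball x r)

/-- `Ψ` restricts to a continuous increasing bijection of `(0, ∞)` with the two-sided power bound
with constants `C`, `β₁`, `β₂`. -/
structure IsScaleFunction (Ψ : ℝ → ℝ) (C β₁ β₂ : ℝ) : Prop where
  continuousOn : ContinuousOn Ψ (Ioi 0)
  strictMonoOn : StrictMonoOn Ψ (Ioi 0)
  bijOn : BijOn Ψ (Ioi 0) (Ioi 0)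
  lower : ∀ r R : ℝ, 0 < r → r ≤ R → C⁻¹ * (R / r) ^ β₁ ≤ Ψ R / Ψ r
  upper : ∀ r R : ℝ, 0 < r → r ≤ R → Ψ R / Ψ r ≤ C * (R / r) ^ β₂

/-- `U` is an `A`-uniform domain. -/
structure IsUniformDomain {X : Type*} [MetricSpace X] (A : ℝ) (U : Set X) : Prop where
  isOpen : IsOpen U
  isConnected : IsConnected U
  ne_univ : U ≠ univ
  exists_curve : ∀ x ∈ U, ∀ y ∈ U, ∃ γ : Path x y, range γ ⊆ U ∧
    Metric.diam (range γ) ≤ A * dist x y ∧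
    ∀ z ∈ range γ, A⁻¹ * min (dist x z) (dist y z) ≤ Metric.infDist z Uᶜ

/-! Let `P` be the dilation in the Poincaré inequality on `X`. Fix a scale `R ≤ r / 4` adapted to
`U` and a corkscrew ball `B(x₀, κR)` at depth comparable to `R`, where depth means distance to `Uᶜ`.
It is enough to bound the `p`-th moment of the distance of `u` to its average on this central ball:
passing to the average over `B_U(x, r)` costs only `2 ^ p`.

Slice the domain by depth about `τ ^ j * R`, with `τ = 1 / (8 * A)`. From a point `y` of slice `j`,
choose corkscrew points at distance `τ ^ k * R / 2` for `k < j` and join consecutive ones by uniform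
curves. Doubling covers each curve by boundedly many balls of radius `κ * τ ^ k * R`, and their
`P`-dilates stay inside `U`. The Poincaré inequality of `X` therefore bounds the `p`-th power of the
`k`-th jump of averages by a multiple of `K * Γ(B ∩ band k) / m(B)`, with `B = B(y, 7Aτ^kR)`
(`edist_average_central_rpow_le`). Adding jumps by `(a + b)^p ≤ (1 + δ)^p a^p + (1 + δ⁻¹)^p b^p`
puts the weight `q ^ (j - k)` on jump `k`, where `q = (1 + δ)^p` is as close to `1` as desired.

The compensating gain is geometric. Integrated over slice `j`, Fubini turns these energy densities
into `Γ(band k)` times the relative measure of the slice in balls of radius about `τ ^ k * R`. Every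
boundary point sees a corkscrew, so a hole-filling argument makes this relative measure at most a
multiple of `λ ^ (j - k)` with `λ < 1` (`measure_boundaryLayer_le`). Choosing `δ` with `q * λ < 1`
makes the double sum converge, and the bands overlap boundedly. Every ball is charged the same
factor `K = C * Ψ r`; all decay comes from the boundary layers.

The estimate is proved down to depth about `τ ^ J * R`, where the local function agrees with a
member of the domain. Its constant is independent of `J`, so `J → ∞` concludes. -/

theorem ENNReal.inv_le_mul_inv_of_le_mul {a b C : ℝ≥0∞} (ha : a ≠ 0) (ha' : a ≠ ∞) (hb : b ≠ 0)
    (hb' : b ≠ ∞) (h : a ≤ C * b) : b⁻¹ ≤ C * a⁻¹ := by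
  rw [← div_eq_mul_inv, ENNReal.le_div_iff_mul_le (Or.inl ha) (Or.inl ha'), mul_comm,
    ← div_eq_mul_inv, ENNReal.div_le_iff hb hb']
  exact h

/-! ### Doubling measures: packing, properness, and Fubini for averages over balls. -/

section Doubling

variable {X : Type*} [MetricSpace X] [MeasurableSpace X] {m : Measure X} {c : ℝ}

theorem VolumeDoubling.measure_ball_two_pow_mul_le (h : VolumeDoubling m c) (n : ℕ) (x : X) {r : ℝ}
    (hr : 0 < r) : m (Metric.ball x (2 ^ n * r)) ≤ ENNReal.ofReal c ^ n * m (Metric.ball x r) := by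
  induction n with
  | zero => simp
  | succ n ih =>
    calc m (Metric.ball x (2 ^ (n + 1) * r)) = m (Metric.ball x (2 * (2 ^ n * r))) := by
          congr 2; ring
      _ ≤ ENNReal.ofReal c * m (Metric.ball x (2 ^ n * r)) := h x _ (by positivity)
      _ ≤ ENNReal.ofReal c * (ENNReal.ofReal c ^ n * m (Metric.ball x r)) := by gcongr
      _ = _ := by ring

theorem VolumeDoubling.measure_ball_le (h : VolumeDoubling m c) {n : ℕ} {x y : X} {r s : ℝ}
    (hr : 0 < r) (hs : dist x y + s ≤ 2 ^ n * r) :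
    m (Metric.ball y s) ≤ ENNReal.ofReal c ^ n * m (Metric.ball x r) := by
  refine (measure_mono (Metric.ball_subset_ball' ?_)).trans (h.measure_ball_two_pow_mul_le n x hr)
  rw [dist_comm]; linarith

theorem VolumeDoubling.measure_ball_lt_top [IsLocallyFiniteMeasure m] (h : VolumeDoubling m c)
    (x : X) (r : ℝ) : m (Metric.ball x r) < ∞ := by
  obtain ⟨s, hs, hsm⟩ := (m.finiteAt_nhds x).exists_mem_basis Metric.nhds_basis_ball
  obtain ⟨n, hn⟩ := pow_unbounded_of_one_lt (r / s) (one_lt_two)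
  refine (h.measure_ball_le (n := n) (x := x) hs ?_).trans_lt
    (ENNReal.mul_lt_top (ENNReal.pow_lt_top ENNReal.ofReal_lt_top) hsm)
  rw [dist_self, zero_add]
  exact ((div_lt_iff₀ hs).1 hn).le

variable [BorelSpace X] [IsLocallyFiniteMeasure m] [m.IsOpenPosMeasure]

/-- A separated family of points in a ball of a doubling space has boundedly many members. -/
theorem VolumeDoubling.card_le_of_separated (h : VolumeDoubling m c) {n : ℕ} {a : X} {T ρ : ℝ}
    (hρ : 0 < ρ) (hT : 2 * T + ρ ≤ 2 ^ n * (ρ / 2)) {ι : Type*} (s : Finset ι) (z : ι → X)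
    (hz : ∀ i ∈ s, dist (z i) a ≤ T)
    (hsep : ∀ i ∈ s, ∀ j ∈ s, i ≠ j → ρ ≤ dist (z i) (z j)) :
    (s.card : ℝ≥0∞) ≤ ENNReal.ofReal c ^ n := by
  rcases s.eq_empty_or_nonempty with rfl | ⟨i₀, hi₀⟩
  · simp
  have hT0 : 0 ≤ T := dist_nonneg.trans (hz i₀ hi₀)
  have hpos : m (Metric.ball a (T + ρ)) ≠ 0 :=
    (Metric.measure_ball_pos m a (by positivity)).ne'
  have hdisj : (s : Set ι).PairwiseDisjoint fun i => Metric.ball (z i) (ρ / 2) := by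
    intro i hi j hj hij
    exact Metric.ball_disjoint_ball (by simpa using hsep i hi j hj hij)
  have hsum : ∑ i ∈ s, m (Metric.ball (z i) (ρ / 2)) ≤ m (Metric.ball a (T + ρ)) := by
    rw [← measure_biUnion_finset hdisj fun i _ => Metric.isOpen_ball.measurableSet]
    refine measure_mono (iUnion₂_subset fun i hi => Metric.ball_subset_ball' ?_)
    have := hz i hi
    linarith
  -- The disjoint balls of radius `ρ / 2` each carry at least the fraction `c ^ (-n)` of the measure
  -- of the large ball.
  have hle : s.card * m (Metric.ball a (T + ρ)) ≤
      ENNReal.ofReal c ^ n * m (Metric.ball a (T + ρ)) := by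
    calc (s.card : ℝ≥0∞) * m (Metric.ball a (T + ρ))
        = ∑ i ∈ s, m (Metric.ball a (T + ρ)) := by simp
      _ ≤ ∑ i ∈ s, ENNReal.ofReal c ^ n * m (Metric.ball (z i) (ρ / 2)) :=
          Finset.sum_le_sum fun i hi => h.measure_ball_le (by positivity) (by
            have := hz i hi
            linarith)
      _ ≤ _ := by rw [← Finset.mul_sum]; gcongr
  rwa [ENNReal.mul_le_mul_iff_left hpos (h.measure_ball_lt_top _ _).ne] at hle

/-- A bounded set that is not totally bounded contains, by greedy choice, arbitrarily many separated
points, against the packing bound. Properness is what later makes the exhausting subsets of the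
domain relatively compact. -/
theorem VolumeDoubling.properSpace [CompleteSpace X] (h : VolumeDoubling m c) : ProperSpace X := by
  refine ⟨fun a T => TotallyBounded.isCompact_of_isClosed ?_ Metric.isClosed_closedBall⟩
  rw [Metric.totallyBounded_iff]
  intro ρ hρ
  by_contra! hcon
  obtain ⟨n, hn⟩ := pow_unbounded_of_one_lt ((2 * T + ρ) / (ρ / 2)) (one_lt_two (α := ℝ))
  obtain ⟨f, hf⟩ := exists_seq_of_forall_finset_exists (fun z => z ∈ Metric.closedBall a T)
    (fun z w => ρ ≤ dist w z) fun s _ => by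
      obtain ⟨w, hw, hws⟩ := not_subset.1 (hcon s s.finite_toSet)
      refine ⟨w, hw, fun z hz => ?_⟩
      simp only [mem_iUnion, not_exists, Metric.mem_ball, not_lt] at hws
      exact hws z hz
  have hsep : ∀ i j, i ≠ j → ρ ≤ dist (f i) (f j) := by
    intro i j hij
    rcases hij.lt_or_gt with hij | hij
    · rw [dist_comm]; exact hf.2 i j hij
    · exact hf.2 j i hij
  have hbound : ∀ k : ℕ, (k : ℝ≥0∞) ≤ ENNReal.ofReal c ^ n := fun k => by
    have := h.card_le_of_separated (n := n) (a := a) (T := T) hρ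
      ((div_lt_iff₀ (by positivity)).1 hn).le (Finset.range k) f (fun i _ => hf.1 i)
      (fun i _ j _ hij => hsep i j hij)
    simpa using this
  obtain ⟨k, hk⟩ := ENNReal.exists_nat_gt
    (ENNReal.pow_lt_top (n := n) (ENNReal.ofReal_lt_top (r := c))).ne
  exact (hbound k).not_gt hk

theorem measurable_measure_ball_inter [SecondCountableTopology X] (ν : Measure X) [SFinite ν]
    {L : Set X} (hL : MeasurableSet L) (ρ : ℝ) :
    Measurable fun y => ν (Metric.ball y ρ ∩ L) := by
  have : MeasurableSet {q : X × X | dist q.2 q.1 < ρ ∧ q.2 ∈ L} :=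
    (measurableSet_lt (f := fun q : X × X => dist q.2 q.1) (by fun_prop) measurable_const).inter
      (measurable_snd hL)
  exact measurable_measure_prodMk_left this

theorem measurable_measure_ball [SecondCountableTopology X] (ν : Measure X) [SFinite ν]
    (ρ : ℝ) : Measurable fun y => ν (Metric.ball y ρ) := by
  simpa using measurable_measure_ball_inter ν MeasurableSet.univ ρ

/-- Fubini's theorem for averages over balls of a fixed radius. -/
theorem VolumeDoubling.lintegral_ball_average_le [SecondCountableTopology X]
    (h : VolumeDoubling m c) {ν : Measure X} [SFinite ν] {E L : Set X} (hE : MeasurableSet E)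
    {ρ : ℝ} (hρ : 0 < ρ) {φ : X → X → ℝ≥0∞}
    (hφ : Measurable (Function.uncurry φ)) :
    ∫⁻ y in E, (∫⁻ z in Metric.ball y ρ ∩ L, φ y z ∂ν) / m (Metric.ball y ρ) ∂m ≤
      ENNReal.ofReal c *
        ∫⁻ z in L, (∫⁻ y in Metric.ball z ρ ∩ E, φ y z ∂m) / m (Metric.ball z ρ) ∂ν := by
  set ψ : X → X → ℝ≥0∞ := fun y z =>
    (Metric.ball y ρ).indicator (fun z => φ y z / m (Metric.ball y ρ)) z with hψ
  have hmeas : Measurable (Function.uncurry ψ) := by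
    have hs : MeasurableSet {q : X × X | dist q.2 q.1 < ρ} :=
      measurableSet_lt (f := fun q : X × X => dist q.2 q.1) (by fun_prop) measurable_const
    have : Function.uncurry ψ = {q : X × X | dist q.2 q.1 < ρ}.indicator
        fun q => φ q.1 q.2 / m (Metric.ball q.1 ρ) := by
      ext q
      simp [hψ, Function.uncurry, indicator]
    rw [this]
    exact (Measurable.div hφ
      ((measurable_measure_ball m ρ).comp (measurable_fst (β := X)))).indicator hs
  have hball : ∀ y : X, MeasurableSet (Metric.ball y ρ) := fun y => Metric.isOpen_ball.measurableSet
  have hleft : ∀ y, (∫⁻ z in Metric.ball y ρ ∩ L, φ y z ∂ν) / m (Metric.ball y ρ) =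
      ∫⁻ z in L, ψ y z ∂ν := fun y => by
    rw [hψ, lintegral_indicator (hball y), Measure.restrict_restrict (hball y)]
    simp_rw [div_eq_mul_inv]
    rw [lintegral_mul_const _ (by fun_prop)]
  simp_rw [hleft]
  rw [lintegral_lintegral_swap hmeas.aemeasurable, ← lintegral_const_mul']
  swap
  · exact ENNReal.ofReal_ne_top
  refine lintegral_mono fun z => ?_
  have hind : ∀ y, ψ y z = (Metric.ball z ρ).indicator (fun y => φ y z / m (Metric.ball y ρ)) y :=
    fun y => by simp [hψ, indicator, dist_comm]
  simp_rw [hind]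
  rw [lintegral_indicator (hball z), Measure.restrict_restrict (hball z), div_eq_mul_inv,
    mul_comm, mul_assoc, ← lintegral_mul_const _ (by fun_prop)]
  refine setLIntegral_mono' ((hball z).inter hE) fun y hy => ?_
  rw [div_eq_mul_inv]
  gcongr
  -- The normalisation must pass from `y` to `z`; since `dist y z < ρ`, one doubling suffices.
  have h1 : m (Metric.ball z ρ) ≤ ENNReal.ofReal c * m (Metric.ball y ρ) := by
    have := h.measure_ball_le (n := 1) (x := y) (y := z) (s := ρ) hρ (by
      have : dist y z < ρ := hy.1
      linarith)
    simpa using this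
  have h2 : m (Metric.ball z ρ) ≠ 0 := (Metric.measure_ball_pos m z hρ).ne'
  have h3 : m (Metric.ball y ρ) ≠ 0 := (Metric.measure_ball_pos m y hρ).ne'
  have h4 := (h.measure_ball_lt_top y ρ).ne
  have h5 := (h.measure_ball_lt_top z ρ).ne
  rw [mul_comm]
  exact ENNReal.inv_le_mul_inv_of_le_mul h2 h5 h3 h4 h1

/-- This is where smallness of `E` at scale `ρ` becomes smallness of an integrated energy density:
after Fubini, the weight at `z` is the relative measure of `E` in `B(z, ρ)`. -/
theorem VolumeDoubling.lintegral_measure_ball_div_le [SecondCountableTopology X]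
    (h : VolumeDoubling m c) {ν : Measure X} [SFinite ν] {E S : Set X} (hE : MeasurableSet E)
    (hS : MeasurableSet S) {ρ : ℝ} (hρ : 0 < ρ) {ε : ℝ≥0∞}
    (hε : ∀ z ∈ S, m (E ∩ Metric.ball z ρ) ≤ ε * m (Metric.ball z ρ)) :
    ∫⁻ y in E, ν (Metric.ball y ρ ∩ S) / m (Metric.ball y ρ) ∂m ≤ ENNReal.ofReal c * (ε * ν S) := by
  calc ∫⁻ y in E, ν (Metric.ball y ρ ∩ S) / m (Metric.ball y ρ) ∂m
      = ∫⁻ y in E, (∫⁻ z in Metric.ball y ρ ∩ S, 1 ∂ν) / m (Metric.ball y ρ) ∂m := by simp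
    _ ≤ ENNReal.ofReal c *
        ∫⁻ z in S, (∫⁻ y in Metric.ball z ρ ∩ E, 1 ∂m) / m (Metric.ball z ρ) ∂ν :=
      h.lintegral_ball_average_le (φ := fun _ _ => 1) hE hρ measurable_const
    _ ≤ ENNReal.ofReal c * ∫⁻ z in S, ε ∂ν := by
      refine mul_le_mul_right (setLIntegral_mono' hS fun z hz => ENNReal.div_le_of_le_mul ?_) _
      rw [lintegral_one, Measure.restrict_apply_univ, inter_comm]
      exact hε z hz
    _ = _ := by simp

end Doubling

/-! ### Averages over balls, and chains along paths. -/

/-- Jensen's inequality for the distance of an average to a constant. -/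
theorem edist_setAverage_rpow_le {X : Type*} [MeasurableSpace X] {m : Measure X} {p : ℝ}
    (hp : 1 ≤ p) {B : Set X} (h0 : m B ≠ 0) (htop : m B ≠ ∞) {f : X → ℝ}
    (hf : IntegrableOn f B m) (a : ℝ) :
    edist (⨍ y in B, f y ∂m) a ^ p ≤ (∫⁻ y in B, edist (f y) a ^ p ∂m) / m B := by
  set μ : Measure X := (m.restrict B univ)⁻¹ • m.restrict B with hμ
  have hres : m.restrict B univ = m B := by simp
  have hprob : IsProbabilityMeasure μ := ⟨by
    rw [hμ, Measure.smul_apply, hres, smul_eq_mul, ENNReal.inv_mul_cancel h0 htop]⟩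
  have hfμ : Integrable f μ := hf.smul_measure (by rw [hres]; exact ENNReal.inv_ne_top.2 h0)
  have h1 : edist (⨍ y in B, f y ∂m) a ≤ eLpNorm (fun y => f y - a) 1 μ := by
    rw [average_eq', edist_eq_enorm_sub, eLpNorm_one_eq_lintegral_enorm]
    have : ∫ y, f y ∂μ - a = ∫ y, (f y - a) ∂μ := by
      rw [integral_sub hfμ (integrable_const _)]; simp
    rw [this]
    exact enorm_integral_le_lintegral_enorm _
  have h2 : eLpNorm (fun y => f y - a) 1 μ ≤ eLpNorm (fun y => f y - a) (ENNReal.ofReal p) μ :=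
    eLpNorm_le_eLpNorm_of_exponent_le (by simpa using hp)
      (hfμ.aestronglyMeasurable.sub aestronglyMeasurable_const)
  have hp0 : 0 < p := by linarith
  calc edist (⨍ y in B, f y ∂m) a ^ p
      ≤ eLpNorm (fun y => f y - a) (ENNReal.ofReal p) μ ^ p := by
        gcongr; exact h1.trans h2
    _ = ∫⁻ y, edist (f y) a ^ p ∂μ := by
        rw [eLpNorm_eq_lintegral_rpow_enorm_toReal (by simpa using hp0) ENNReal.ofReal_ne_top,
          ENNReal.toReal_ofReal hp0.le, ← ENNReal.rpow_mul, one_div_mul_cancel hp0.ne',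
          ENNReal.rpow_one]
        simp_rw [edist_eq_enorm_sub]
    _ = _ := by
        rw [hμ, lintegral_smul_measure, hres, smul_eq_mul, div_eq_mul_inv, mul_comm]

theorem measurable_setAverage_ball {X : Type*} [MetricSpace X] [MeasurableSpace X] [BorelSpace X]
    [SecondCountableTopology X] {m : Measure X} [SFinite m] {f : X → ℝ} (hf : Measurable f)
    (ρ : ℝ) : Measurable fun z => ⨍ y in Metric.ball z ρ, f y ∂m := by
  have hs : MeasurableSet {q : X × X | dist q.2 q.1 < ρ} :=
    measurableSet_lt (f := fun q : X × X => dist q.2 q.1) (by fun_prop) measurable_const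
  have h1 : Measurable fun z => ∫ y in Metric.ball z ρ, f y ∂m := by
    have h2 : StronglyMeasurable fun q : X × X => {q : X × X | dist q.2 q.1 < ρ}.indicator
        (fun q => f q.2) q := ((hf.comp measurable_snd).indicator hs).stronglyMeasurable
    have h3 := (h2.integral_prod_right' (ν := m)).measurable
    convert h3 using 2 with z
    rw [← integral_indicator Metric.isOpen_ball.measurableSet]
    rfl
  simp_rw [setAverage_eq]
  exact ((measurable_measure_ball m ρ).ennreal_toReal.inv).smul h1

/-- Two points of a path are joined by a shortest chain of points of the path with small steps:
two of its points that are not neighbours are far from each other. -/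
theorem Path.exists_separated_chain {X : Type*} [PseudoMetricSpace X] {x y : X} (γ : Path x y)
    {ρ : ℝ} (hρ : 0 < ρ) : ∃ (n : ℕ) (z : ℕ → X), z 0 = x ∧ z n = y ∧ (∀ i, z i ∈ range γ) ∧
      (∀ i < n, dist (z i) (z (i + 1)) < ρ) ∧
      ∀ i j, i + 2 ≤ j → j ≤ n → ρ ≤ dist (z i) (z j) := by
  classical
  have hex : ∃ (n : ℕ) (z : ℕ → X), z 0 = x ∧ z n = y ∧ (∀ i, z i ∈ range γ) ∧
      ∀ i < n, dist (z i) (z (i + 1)) < ρ := by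
    obtain ⟨δ, hδ, hγ⟩ := Metric.uniformContinuous_iff.1
      (CompactSpace.uniformContinuous_of_continuous γ.continuous) ρ hρ
    obtain ⟨n, hn⟩ := exists_nat_gt (1 / δ)
    have hn0 : (0 : ℝ) < n := (by positivity : (0 : ℝ) < 1 / δ).trans hn
    refine ⟨n, fun i => γ (projIcc 0 1 zero_le_one (i / n)), by simp, ?_, fun i => ⟨_, rfl⟩,
      fun i _ => hγ ?_⟩
    · simp [div_self hn0.ne']
    · have h1 : dist (projIcc (0 : ℝ) 1 zero_le_one (i / n))
          (projIcc (0 : ℝ) 1 zero_le_one ((i + 1 : ℕ) / n)) ≤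
          dist ((i : ℝ) / n) ((i + 1 : ℕ) / n) := by
        simpa using (LipschitzWith.projIcc (zero_le_one (α := ℝ))).dist_le_mul
          ((i : ℝ) / n) ((i + 1 : ℕ) / n)
      refine h1.trans_lt ?_
      rw [Real.dist_eq, ← sub_div, abs_div, abs_of_pos hn0]
      push_cast
      rw [sub_add_cancel_left, abs_neg, abs_one, div_lt_iff₀ hn0]
      rw [div_lt_iff₀ hδ] at hn
      linarith
  obtain ⟨z, h0, hn, hz, hstep⟩ := Nat.find_spec hex
  refine ⟨Nat.find hex, z, h0, hn, hz, hstep, fun i j hij hj => ?_⟩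
  by_contra! hlt
  set n := Nat.find hex with hn_def
  -- If two non-neighbours were close, deleting the `j - i - 1` points between them would give a
  -- shorter chain.
  refine Nat.find_min hex (m := n - (j - i - 1)) (by omega)
    ⟨fun l => if l ≤ i then z l else z (l + (j - i - 1)), by simp [h0], ?_, ?_, ?_⟩
  · simp only
    split_ifs with h
    · have h1 : n = j := by omega
      have h2 : n - (j - i - 1) = i + 1 := by omega
      omega
    · rw [show n - (j - i - 1) + (j - i - 1) = n by omega, hn]
  · intro l
    simp only
    split_ifs <;> exact hz _
  · intro l hl
    simp only
    split_ifs with h1 h2 h2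
    · exact hstep l (by omega)
    · have h3 : l = i := by omega
      subst h3
      rwa [show l + 1 + (j - l - 1) = j by omega]
    · omega
    · have := hstep (l + (j - i - 1)) (by omega)
      rwa [show l + 1 + (j - i - 1) = l + (j - i - 1) + 1 by omega]

/-! ### Uniform domains: corkscrew points and decay of boundary layers. -/

/-- The part of `U` whose distance to the complement of `U` is less than `t`. -/
def boundaryLayer {X : Type*} [MetricSpace X] (U : Set X) (t : ℝ) : Set X :=
  {y ∈ U | Metric.infDist y Uᶜ < t}

theorem boundaryLayer_mono {X : Type*} [MetricSpace X] (U : Set X) {s t : ℝ} (h : s ≤ t) :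
    boundaryLayer U s ⊆ boundaryLayer U t := fun _ hy => ⟨hy.1, hy.2.trans_le h⟩

theorem measurableSet_boundaryLayer {X : Type*} [MetricSpace X] [MeasurableSpace X] [BorelSpace X]
    {U : Set X} (hU : IsOpen U) (t : ℝ) : MeasurableSet (boundaryLayer U t) :=
  (hU.inter (isOpen_lt (Metric.continuous_infDist_pt _) continuous_const)).measurableSet

theorem mem_of_infDist_compl_pos {X : Type*} [MetricSpace X] {U : Set X} {y : X}
    (h : 0 < Metric.infDist y Uᶜ) : y ∈ U := by
  by_contra hy
  rw [Metric.infDist_zero_of_mem hy] at h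
  exact h.false

namespace IsUniformDomain

variable {X : Type*} [MetricSpace X] {A : ℝ} {U : Set X}

theorem infDist_compl_pos (hU : IsUniformDomain A U) {y : X} (hy : y ∈ U) :
    0 < Metric.infDist y Uᶜ := by
  rw [← hU.isOpen.isClosed_compl.notMem_iff_infDist_pos (nonempty_compl.2 hU.ne_univ)]
  simpa using hy

/-- By continuity the uniform curve from `y` to `w` crosses the sphere of radius `s / 2` about `y`.
There it is at distance at least `s / 2` from both ends, so the uniformity condition gives the
depth. -/
theorem exists_corkscrew (hU : IsUniformDomain A U) (hA : 1 ≤ A) {y w : X} (hy : y ∈ U)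
    (hw : w ∈ U) {s : ℝ} (hs : 0 < s) (hsw : s ≤ dist y w) :
    ∃ z ∈ U, dist y z = s / 2 ∧ s / (2 * A) ≤ Metric.infDist z Uᶜ := by
  obtain ⟨γ, hγU, -, hγ⟩ := hU.exists_curve y hy w hw
  obtain ⟨t, ht⟩ := mem_range_of_exists_le_of_exists_ge (c := s / 2)
    (f := fun t => dist y (γ t)) (by fun_prop) ⟨0, by simp; positivity⟩ ⟨1, by simp; linarith⟩
  refine ⟨γ t, hγU ⟨t, rfl⟩, ht, le_trans ?_ (hγ _ ⟨t, rfl⟩)⟩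
  have h1 : s / 2 ≤ dist w (γ t) := by
    have := dist_triangle_right y w (γ t)
    simp only at ht
    linarith
  calc s / (2 * A) = A⁻¹ * (s / 2) := by field_simp
    _ ≤ _ := by gcongr; exact le_min ht.ge h1

/-- The points of a uniform curve between two points far from the boundary are far from the
boundary. -/
theorem le_infDist_of_mem_curve (hA : 1 ≤ A) {a b z : X} {s : ℝ}
    (ha : s ≤ Metric.infDist a Uᶜ) (hb : s ≤ Metric.infDist b Uᶜ)
    (hz : A⁻¹ * min (dist a z) (dist b z) ≤ Metric.infDist z Uᶜ) (hs : 0 < s) :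
    s / (2 * A) ≤ Metric.infDist z Uᶜ := by
  have h1 : s / (2 * A) ≤ s / 2 := by gcongr; linarith
  have h2 := Metric.infDist_le_infDist_add_dist (s := Uᶜ) (x := a) (y := z)
  have h3 := Metric.infDist_le_infDist_add_dist (s := Uᶜ) (x := b) (y := z)
  -- Far from both ends the curve condition applies; within `s / 2` of an end, depth is at least `s
  -- / 2` because it is `1`-Lipschitz.
  by_cases h : s / 2 ≤ min (dist a z) (dist b z)
  · refine le_trans ?_ hz
    calc s / (2 * A) = A⁻¹ * (s / 2) := by field_simp
      _ ≤ _ := by gcongr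
  · rw [le_min_iff, not_and_or] at h
    rcases h with h | h <;> linarith

variable [MeasurableSpace X] [BorelSpace X] {m : Measure X} {c R : ℝ}
  [IsLocallyFiniteMeasure m] [m.IsOpenPosMeasure] [SecondCountableTopology X]

/-- Near each point of the thin layer there is a corkscrew ball of radius comparable to `t` inside
the difference of the layers. Hence the difference has density bounded below in every `B(y, t)`;
integrating over the thin layer and applying Fubini compares the measures. -/
theorem measure_boundaryLayer_le_mul_diff (hU : IsUniformDomain A U) (hA : 1 ≤ A)
    (hm : VolumeDoubling m c) (hR : ∀ y ∈ U, ∃ w ∈ U, R ≤ dist y w) {n : ℕ} (hn : 10 * A ≤ 2 ^ n)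
    {t : ℝ} (ht : 0 < t) (htR : t ≤ 2 * R) (a : X) (ρ : ℝ) :
    m (boundaryLayer U (1 / (8 * A) * t) ∩ Metric.ball a ρ) ≤ ENNReal.ofReal c ^ (n + 1) *
      m ((boundaryLayer U t \ boundaryLayer U (1 / (8 * A) * t)) ∩ Metric.ball a (ρ + t)) := by
  set τ : ℝ := 1 / (8 * A) with hτ
  have hτ0 : 0 < τ := by positivity
  have hτA : τ * A = 1 / 8 := by rw [hτ]; field_simp
  set E := boundaryLayer U (τ * t) ∩ Metric.ball a ρ with hE
  set D := (boundaryLayer U t \ boundaryLayer U (τ * t)) ∩ Metric.ball a (ρ + t) with hD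
  have hEm : MeasurableSet E := (measurableSet_boundaryLayer hU.isOpen _).inter
    Metric.isOpen_ball.measurableSet
  have hDm : MeasurableSet D := ((measurableSet_boundaryLayer hU.isOpen _).diff
    (measurableSet_boundaryLayer hU.isOpen _)).inter Metric.isOpen_ball.measurableSet
  have key : ∀ y ∈ E, 1 ≤ ENNReal.ofReal c ^ n *
      (m (Metric.ball y t ∩ D) / m (Metric.ball y t)) := by
    rintro y ⟨⟨hyU, hyd⟩, hya⟩
    obtain ⟨w, hw, hRw⟩ := hR y hyU
    -- With scale `t / 2`, the corkscrew has depth at least `t / (4 * A) = 2 * τ * t` and lies at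
    -- distance `t / 4` from `y`. Thus depths in `B(z, τ * t)` stay between `τ * t` and `t`.
    obtain ⟨z, hzU, hyz, hdz⟩ := hU.exists_corkscrew hA hyU hw (s := t / 2) (by positivity)
      (by linarith)
    have hdz' : 2 * (τ * t) ≤ Metric.infDist z Uᶜ := by
      refine le_trans (le_of_eq ?_) hdz
      rw [hτ]; field_simp; norm_num
    have hτt : τ * t ≤ t / 8 := by nlinarith
    have hsub : Metric.ball z (τ * t) ⊆ Metric.ball y t ∩ D := by
      intro v hv
      rw [Metric.mem_ball] at hv hya
      have h1 := Metric.infDist_le_infDist_add_dist (s := Uᶜ) (x := z) (y := v)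
      have h2 := Metric.infDist_le_infDist_add_dist (s := Uᶜ) (x := v) (y := y)
      rw [dist_comm z v] at h1
      have h3 := dist_triangle v z y
      rw [dist_comm z y] at h3
      have h5 := dist_triangle v y a
      refine ⟨by rw [Metric.mem_ball]; linarith,
        ⟨⟨mem_of_infDist_compl_pos (by linarith [mul_pos hτ0 ht]), ?_⟩, fun h4 => ?_⟩, ?_⟩
      · linarith
      · have := h4.2
        linarith
      · rw [Metric.mem_ball]; linarith
    have hB0 : m (Metric.ball y t) ≠ 0 := (Metric.measure_ball_pos m y ht).ne'
    rw [← mul_div_assoc,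
      ENNReal.le_div_iff_mul_le (Or.inl hB0) (Or.inl (hm.measure_ball_lt_top y t).ne), one_mul]
    calc m (Metric.ball y t) ≤ ENNReal.ofReal c ^ n * m (Metric.ball z (τ * t)) := by
          refine hm.measure_ball_le (by positivity) ?_
          rw [dist_comm, hyz]
          have : 10 * A * (τ * t) ≤ 2 ^ n * (τ * t) := by gcongr
          have h2 : 10 * A * (τ * t) = 10 * (τ * A) * t := by ring
          rw [h2, hτA] at this
          linarith
      _ ≤ _ := by gcongr
  calc m E = ∫⁻ y in E, 1 ∂m := by simp
    _ ≤ ∫⁻ y in E, ENNReal.ofReal c ^ n *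
        (m (Metric.ball y t ∩ D) / m (Metric.ball y t)) ∂m :=
      setLIntegral_mono' hEm key
    _ ≤ ENNReal.ofReal c ^ n * (ENNReal.ofReal c * (1 * m D)) := by
      rw [lintegral_const_mul' _ _ (ENNReal.pow_lt_top ENNReal.ofReal_lt_top).ne]
      gcongr
      exact hm.lintegral_measure_ball_div_le hEm hDm ht fun z _ => by
        rw [one_mul]; exact measure_mono inter_subset_right
    _ = _ := by ring

/-- The relative measure of the boundary layers of a uniform domain decays geometrically. -/
theorem measure_boundaryLayer_le (hU : IsUniformDomain A U) (hA : 1 ≤ A)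
    (hm : VolumeDoubling m c) (hR : ∀ y ∈ U, ∃ w ∈ U, R ≤ dist y w) {n : ℕ} (hn : 10 * A ≤ 2 ^ n)
    {M : ℝ≥0∞} (hM : M = ENNReal.ofReal c ^ (n + 1)) (i : ℕ)
    {t : ℝ} (ht : 0 < t) (htR : t ≤ 2 * R) (a : X) (ρ : ℝ) :
    m (boundaryLayer U ((1 / (8 * A)) ^ i * t) ∩ Metric.ball a ρ) ≤
      (M / (1 + M)) ^ i * m (boundaryLayer U t ∩ Metric.ball a (ρ + 2 * t)) := by
  have hM1 : 1 + M ≠ 0 := by simp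
  have hMtop : 1 + M ≠ ∞ := by
    rw [hM]; exact (ENNReal.add_lt_top.2 ⟨by simp, ENNReal.pow_lt_top ENNReal.ofReal_lt_top⟩).ne
  induction i generalizing t ρ with
  | zero =>
    rw [pow_zero, pow_zero, one_mul, one_mul]
    exact measure_mono (inter_subset_inter_right _ (Metric.ball_subset_ball (by linarith)))
  | succ i ih =>
    set τ : ℝ := 1 / (8 * A) with hτ
    have hτ8 : τ ≤ 1 / 8 := by
      rw [hτ]; gcongr; linarith
    have hτt : τ * t ≤ t / 8 := by nlinarith
    -- The radius budget closes because `2 * τ * t + t ≤ 2 * t`.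
    have h1 := hU.measure_boundaryLayer_le_mul_diff hA hm hR hn ht htR a (ρ + 2 * (τ * t))
    rw [← hτ, ← hM] at h1
    set B := Metric.ball a (ρ + 2 * (τ * t)) with hB
    set B' := Metric.ball a (ρ + 2 * (τ * t) + t) with hB'
    have h2 : m (boundaryLayer U (τ * t) ∩ B) ≤ m (boundaryLayer U (τ * t) ∩ B') :=
      measure_mono (inter_subset_inter_right _ (Metric.ball_subset_ball (by linarith)))
    have h3 : m (boundaryLayer U (τ * t) ∩ B') +
        m ((boundaryLayer U t \ boundaryLayer U (τ * t)) ∩ B') ≤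
        m (boundaryLayer U t ∩ Metric.ball a (ρ + 2 * t)) := by
      rw [← measure_union _ (((measurableSet_boundaryLayer hU.isOpen _).diff
        (measurableSet_boundaryLayer hU.isOpen _)).inter Metric.isOpen_ball.measurableSet)]
      · rw [← union_inter_distrib_right, union_sdiff_cancel (boundaryLayer_mono U (by linarith))]
        exact measure_mono (inter_subset_inter_right _ (Metric.ball_subset_ball (by linarith)))
      · exact disjoint_sdiff_right.mono inter_subset_left inter_subset_left
    -- Hole filling: adding `M` times the thin layer to both sides of `h1` produces the ratio `M /
    -- (1 + M) < 1`.
    have h4 : m (boundaryLayer U (τ * t) ∩ B) ≤ M / (1 + M) *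
        m (boundaryLayer U t ∩ Metric.ball a (ρ + 2 * t)) := by
      rw [mul_comm (M / (1 + M)), ← mul_div_assoc,
        ENNReal.le_div_iff_mul_le (Or.inl hM1) (Or.inl hMtop)]
      calc m (boundaryLayer U (τ * t) ∩ B) * (1 + M)
          = m (boundaryLayer U (τ * t) ∩ B) + M * m (boundaryLayer U (τ * t) ∩ B) := by ring
        _ ≤ M * m ((boundaryLayer U t \ boundaryLayer U (τ * t)) ∩ B') +
            M * m (boundaryLayer U (τ * t) ∩ B') := by gcongr
        _ = (m (boundaryLayer U (τ * t) ∩ B') +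
            m ((boundaryLayer U t \ boundaryLayer U (τ * t)) ∩ B')) * M := by ring
        _ ≤ _ := by gcongr
    calc m (boundaryLayer U (τ ^ (i + 1) * t) ∩ Metric.ball a ρ)
        = m (boundaryLayer U (τ ^ i * (τ * t)) ∩ Metric.ball a ρ) := by rw [pow_succ, mul_assoc]
      _ ≤ (M / (1 + M)) ^ i * m (boundaryLayer U (τ * t) ∩ B) :=
          ih (by positivity) (by linarith) ρ
      _ ≤ (M / (1 + M)) ^ i *
          (M / (1 + M) * m (boundaryLayer U t ∩ Metric.ball a (ρ + 2 * t))) := by gcongr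
      _ = _ := by ring

end IsUniformDomain

/-! ### Comparing averages over balls deep inside the domain. -/

/-- The function `f` satisfies a `(p,p)`-Poincaré inequality with right-hand side given by the
measure `Γ`, for balls of radius at most `R`. -/
structure HasPoincareUpTo {X : Type*} [MetricSpace X] [MeasurableSpace X] (m : Measure X)
    (f : X → ℝ) (Γ : Measure X) (p P R : ℝ) (K : ℝ≥0∞) : Prop where
  integrableOn_ball : ∀ z ρ, IntegrableOn f (Metric.ball z ρ) m
  lintegral_le : ∀ z ρ, 0 < ρ → ρ ≤ R →
    ∫⁻ y in Metric.ball z ρ, edist (f y) (⨍ w in Metric.ball z ρ, f w ∂m) ^ p ∂m ≤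
      K * Γ (Metric.ball z (P * ρ))

/-- The points at distance less than `7 * A * s` from `y` whose distance to the complement of `U`
is at least `θ / (4 * A) * s`. -/
def deepBall {X : Type*} [MetricSpace X] (U : Set X) (A θ s : ℝ) (y : X) : Set X :=
  Metric.ball y (7 * A * s) ∩ {v | θ / (4 * A) * s ≤ Metric.infDist v Uᶜ}

namespace HasPoincareUpTo

variable {X : Type*} [MetricSpace X] [MeasurableSpace X] {m : Measure X}
  [IsLocallyFiniteMeasure m] [m.IsOpenPosMeasure] {A c p P R : ℝ} {K : ℝ≥0∞} {U : Set X}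
  {f : X → ℝ} {Γ : Measure X}

/-- Jensen reduces the claim to the Poincaré inequality on `B(z, 2κs)`. The condition `8 * A * P * κ
≤ θ` keeps the dilated ball at half the depth of `z` or more, hence inside `deepBall`, and doubling
changes the normalising ball to one about `y`. -/
theorem edist_average_rpow_le (hf : HasPoincareUpTo m f Γ p P R K) (hm : VolumeDoubling m c)
    (hp : 1 ≤ p) (hA : 1 ≤ A) (hP : 1 ≤ P) {θ κ s : ℝ} (hκ : 0 < κ) (hκθ : 8 * A * P * κ ≤ θ)
    (hθ : θ ≤ 1) (hs : 0 < s) (hsR : s ≤ R) {y z z' : X} {ρ : ℝ} (hρ : 0 < ρ)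
    {n : ℕ} (hn : 14 * A * s ≤ 2 ^ n * ρ) (hyz : dist z y ≤ 6 * A * s)
    (hz : θ * s / (2 * A) ≤ Metric.infDist z Uᶜ)
    (hsub : Metric.ball z' ρ ⊆ Metric.ball z (2 * (κ * s))) :
    edist (⨍ w in Metric.ball z' ρ, f w ∂m) (⨍ w in Metric.ball z (2 * (κ * s)), f w ∂m) ^ p ≤
      ENNReal.ofReal c ^ n *
        (K * (Γ (deepBall U A θ s y) / m (Metric.ball y (7 * A * s)))) := by
  have hκs : 0 < κ * s := mul_pos hκ hs
  have h8 : 8 * A * P * (κ * s) ≤ θ * s := by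
    have := mul_le_mul_of_nonneg_right hκθ hs.le
    linarith
  have hθs : θ * s ≤ s := by nlinarith
  have hAκ : P * (κ * s) ≤ A * P * (κ * s) := by
    have : P ≤ A * P := le_mul_of_one_le_left (by linarith) hA
    gcongr
  have hPκ : κ * s ≤ P * (κ * s) := le_mul_of_one_le_left hκs.le hP
  have hAs : s ≤ A * s := le_mul_of_one_le_left hs.le hA
  have hz' : dist z' y < 7 * A * s := by
    have h1 : z' ∈ Metric.ball z (2 * (κ * s)) := hsub (Metric.mem_ball_self hρ)
    rw [Metric.mem_ball] at h1
    have := dist_triangle z' z y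
    nlinarith
  have hB0 : m (Metric.ball z' ρ) ≠ 0 := (Metric.measure_ball_pos m z' hρ).ne'
  have hBtop := (hm.measure_ball_lt_top z' ρ).ne
  have hb0 : m (Metric.ball y (7 * A * s)) ≠ 0 :=
    (Metric.measure_ball_pos m y (by positivity)).ne'
  have hbtop := (hm.measure_ball_lt_top y (7 * A * s)).ne
  have hinv : (m (Metric.ball z' ρ))⁻¹ ≤
      ENNReal.ofReal c ^ n * (m (Metric.ball y (7 * A * s)))⁻¹ :=
    ENNReal.inv_le_mul_inv_of_le_mul hb0 hbtop hB0 hBtop (hm.measure_ball_le hρ (by linarith))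
  have hS : Metric.ball z (P * (2 * (κ * s))) ⊆ deepBall U A θ s y := by
    intro v hv
    rw [Metric.mem_ball] at hv
    constructor
    · rw [Metric.mem_ball]
      have := dist_triangle v z y
      linarith
    · have h1 := Metric.infDist_le_infDist_add_dist (s := Uᶜ) (x := z) (y := v)
      rw [dist_comm z v] at h1
      have h2 : P * (2 * (κ * s)) ≤ θ / (4 * A) * s := by
        rw [div_mul_eq_mul_div, le_div_iff₀ (by positivity)]
        linarith
      have h3 : θ * s / (2 * A) = 2 * (θ / (4 * A) * s) := by field_simp; norm_num
      change θ / (4 * A) * s ≤ Metric.infDist v Uᶜ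
      linarith
  calc edist (⨍ w in Metric.ball z' ρ, f w ∂m) (⨍ w in Metric.ball z (2 * (κ * s)), f w ∂m) ^ p
      ≤ (∫⁻ v in Metric.ball z' ρ,
          edist (f v) (⨍ w in Metric.ball z (2 * (κ * s)), f w ∂m) ^ p ∂m) /
        m (Metric.ball z' ρ) :=
      edist_setAverage_rpow_le hp hB0 hBtop (hf.integrableOn_ball _ _) _
    _ ≤ (∫⁻ v in Metric.ball z (2 * (κ * s)),
        edist (f v) (⨍ w in Metric.ball z (2 * (κ * s)), f w ∂m) ^ p ∂m) /
        m (Metric.ball z' ρ) := by gcongr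
    _ ≤ K * Γ (deepBall U A θ s y) / m (Metric.ball z' ρ) := by
      gcongr
      refine (hf.lintegral_le z _ (by positivity) (by linarith)).trans ?_
      gcongr
    _ ≤ K * Γ (deepBall U A θ s y) *
        (ENNReal.ofReal c ^ n * (m (Metric.ball y (7 * A * s)))⁻¹) := by
      rw [div_eq_mul_inv]; gcongr
    _ = _ := by rw [div_eq_mul_inv]; ring

theorem edist_average_le (hf : HasPoincareUpTo m f Γ p P R K) (hm : VolumeDoubling m c)
    (hp : 1 ≤ p) (hA : 1 ≤ A) (hP : 1 ≤ P) {θ κ s : ℝ} (hκ : 0 < κ) (hκθ : 8 * A * P * κ ≤ θ)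
    (hθ : θ ≤ 1) (hs : 0 < s) (hsR : s ≤ R) {y z z₁ z₂ : X} {ρ₁ ρ₂ : ℝ} (hρ₁ : 0 < ρ₁)
    (hρ₂ : 0 < ρ₂) {n : ℕ} (hn₁ : 14 * A * s ≤ 2 ^ n * ρ₁) (hn₂ : 14 * A * s ≤ 2 ^ n * ρ₂)
    (hyz : dist z y ≤ 6 * A * s) (hz : θ * s / (2 * A) ≤ Metric.infDist z Uᶜ)
    (hsub₁ : Metric.ball z₁ ρ₁ ⊆ Metric.ball z (2 * (κ * s)))
    (hsub₂ : Metric.ball z₂ ρ₂ ⊆ Metric.ball z (2 * (κ * s))) :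
    edist (⨍ w in Metric.ball z₁ ρ₁, f w ∂m) (⨍ w in Metric.ball z₂ ρ₂, f w ∂m) ≤
      2 * (ENNReal.ofReal c ^ n *
        (K * (Γ (deepBall U A θ s y) / m (Metric.ball y (7 * A * s))))) ^ p⁻¹ := by
  have hp0 : 0 < p := by linarith
  have h1 := hf.edist_average_rpow_le hm hp hA hP hκ hκθ hθ hs hsR hρ₁ hn₁ hyz hz hsub₁
  have h2 := hf.edist_average_rpow_le hm hp hA hP hκ hκθ hθ hs hsR hρ₂ hn₂ hyz hz hsub₂
  rw [← ENNReal.le_rpow_inv_iff hp0] at h1 h2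
  rw [two_mul]
  exact (edist_triangle_right _ _ _).trans (add_le_add h1 h2)

/-- A shortest chain along the uniform curve from `a` to `b` has boundedly many links, and each link
is controlled by the same energy density about `y`. -/
theorem edist_average_chain_le [BorelSpace X] (hf : HasPoincareUpTo m f Γ p P R K)
    (hU : IsUniformDomain A U)
    (hm : VolumeDoubling m c) (hp : 1 ≤ p) (hA : 1 ≤ A) (hP : 1 ≤ P) {θ κ s : ℝ} (hκ : 0 < κ)
    (hκθ : 8 * A * P * κ ≤ θ) (hθ0 : 0 < θ) (hθ : θ ≤ 1) (hs : 0 < s) (hsR : s ≤ R) {n : ℕ}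
    (hn : 22 * A ≤ 2 ^ n * κ) {y a b : X} (ha : a ∈ U) (hb : b ∈ U) (hya : dist a y ≤ s)
    (hab : dist a b ≤ 5 * s) (hda : θ * s ≤ Metric.infDist a Uᶜ)
    (hdb : θ * s ≤ Metric.infDist b Uᶜ) :
    edist (⨍ w in Metric.ball a (κ * s), f w ∂m) (⨍ w in Metric.ball b (κ * s), f w ∂m) ≤
      4 * ENNReal.ofReal c ^ n * (ENNReal.ofReal c ^ n *
        (K * (Γ (deepBall U A θ s y) / m (Metric.ball y (7 * A * s))))) ^ p⁻¹ := by
  have hκs : 0 < κ * s := mul_pos hκ hs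
  have hAs : s ≤ A * s := le_mul_of_one_le_left hs.le hA
  have hκ1 : κ ≤ 1 := by
    have : 1 ≤ A * P := one_le_mul_of_one_le_of_one_le hA hP
    nlinarith
  have hκs1 : κ * s ≤ A * s := by gcongr; linarith
  have hns : 22 * A * s ≤ 2 ^ n * (κ * s) := by
    rw [← mul_assoc]; gcongr
  obtain ⟨γ, hγU, hdiam, hγ⟩ := hU.exists_curve a ha b hb
  obtain ⟨k, z, hz0, hzk, hzγ, hstep, hsep⟩ := γ.exists_separated_chain hκs
  have hza : ∀ i, dist (z i) a ≤ 5 * A * s := fun i => by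
    have h1 := Metric.dist_le_diam_of_mem (isCompact_range γ.continuous).isBounded (hzγ i)
      ⟨0, γ.source⟩
    have h2 : A * dist a b ≤ A * (5 * s) := by gcongr
    linarith
  -- Only non-neighbours are separated, so packing is applied to the even-indexed points. The
  -- constant `22` covers `2 * (2 * 5 + 1)`.
  have hk : (k : ℝ≥0∞) ≤ 2 * ENNReal.ofReal c ^ n := by
    have h1 := hm.card_le_of_separated hκs (n := n) (a := a) (T := 5 * A * s) (by linarith)
      (Finset.range (k / 2 + 1)) (fun i => z (2 * i)) (fun i _ => hza _) fun i hi j hj hij => by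
        rw [Finset.mem_range] at hi hj
        rcases hij.lt_or_gt with h | h
        · exact hsep _ _ (by omega) (by omega)
        · rw [dist_comm]
          exact hsep _ _ (by omega) (by omega)
    rw [Finset.card_range] at h1
    calc (k : ℝ≥0∞) ≤ (2 * (k / 2 + 1) : ℕ) := by
          exact_mod_cast (by omega : k ≤ 2 * (k / 2 + 1))
      _ = 2 * ((k / 2 + 1 : ℕ) : ℝ≥0∞) := by push_cast; ring
      _ ≤ _ := by gcongr
  set δ := (ENNReal.ofReal c ^ n *
    (K * (Γ (deepBall U A θ s y) / m (Metric.ball y (7 * A * s))))) ^ p⁻¹ with hδ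
  have hone : ∀ i < k, edist (⨍ w in Metric.ball (z i) (κ * s), f w ∂m)
      (⨍ w in Metric.ball (z (i + 1)) (κ * s), f w ∂m) ≤ 2 * δ := fun i hi => by
    refine hf.edist_average_le hm hp hA hP hκ hκθ hθ hs hsR (z := z i) hκs hκs (by linarith)
      (by linarith) ?_ ?_ (Metric.ball_subset_ball (by linarith)) (Metric.ball_subset_ball' ?_)
    · have := dist_triangle (z i) a y
      have := hza i
      linarith
    · exact IsUniformDomain.le_infDist_of_mem_curve hA hda hdb (hγ _ (hzγ i)) (by positivity)
    · have := hstep i hi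
      rw [dist_comm] at this
      linarith
  have hsum := edist_le_range_sum_edist (fun i => ⨍ w in Metric.ball (z i) (κ * s), f w ∂m) k
  simp only [hz0, hzk] at hsum
  calc _ ≤ _ := hsum
    _ ≤ ∑ i ∈ Finset.range k, 2 * δ :=
      Finset.sum_le_sum fun i hi => hone i (Finset.mem_range.1 hi)
    _ = k * (2 * δ) := by simp
    _ ≤ 2 * ENNReal.ofReal c ^ n * (2 * δ) := by gcongr
    _ = _ := by ring

end HasPoincareUpTo

/-! ### Summation of jumps and the chain from a point to the central ball. -/

/-- Either `b ≤ δ * a` or `a ≤ δ⁻¹ * b`, and one term alone suffices. A coefficient near `1` on `a ^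
p` keeps iteration from outrunning the decay of the layers. -/
theorem ENNReal.add_rpow_le {p : ℝ} (hp : 0 ≤ p) (a b : ℝ≥0∞) {δ : ℝ≥0∞} (hδ : δ ≠ 0)
    (hδ' : δ ≠ ∞) : (a + b) ^ p ≤ (1 + δ) ^ p * a ^ p + (1 + δ⁻¹) ^ p * b ^ p := by
  rw [← ENNReal.mul_rpow_of_nonneg _ _ hp, ← ENNReal.mul_rpow_of_nonneg _ _ hp]
  rcases le_total b (δ * a) with h | h
  · refine le_trans ?_ le_self_add
    gcongr
    rw [add_mul, one_mul]
    gcongr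
  · refine le_trans ?_ le_add_self
    gcongr
    rw [add_mul, one_mul, add_comm]
    gcongr
    rw [← ENNReal.mul_le_mul_iff_right hδ hδ', ← mul_assoc, ENNReal.mul_inv_cancel hδ hδ', one_mul]
    exact h

/-- Geometric summation of the increments of a sequence. -/
theorem edist_rpow_le_sum_geometric {v : ℕ → ℝ} {a p : ℝ} (hp : 1 ≤ p) {C δ : ℝ≥0∞} (hδ : δ ≠ 0)
    (hδ' : δ ≠ ∞) {H : ℕ → ℝ≥0∞} {j : ℕ} (h0 : edist (v 0) a ^ p ≤ C * H 0)
    (hstep : ∀ k < j, edist (v (k + 1)) (v k) ^ p ≤ C * H k) :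
    edist (v j) a ^ p ≤ 2 * (C * (1 + δ⁻¹) ^ p) *
      ∑ k ∈ Finset.range (j + 1), ((1 + δ) ^ p) ^ (j - k) * H k := by
  set q := (1 + δ) ^ p with hq
  set D := C * (1 + δ⁻¹) ^ p with hD
  have hp0 : 0 < p := by linarith
  have hq1 : 1 ≤ q := ENNReal.one_le_rpow le_self_add hp0
  have hδ1 : 1 ≤ (1 + δ⁻¹) ^ p := ENNReal.one_le_rpow le_self_add hp0
  -- `H 0` pays both for the comparison of `v 0` with `a` and for the first increment; the factor
  -- `2` in the conclusion absorbs this.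
  have key : ∀ i ≤ j, edist (v i) a ^ p ≤
      D * (q ^ i * H 0 + ∑ k ∈ Finset.range i, q ^ (i - k) * H k) := by
    intro i
    induction i with
    | zero =>
      intro _
      simp only [pow_zero, one_mul, Finset.range_zero, Finset.sum_empty, add_zero]
      refine h0.trans ?_
      gcongr
      exact le_mul_of_one_le_right' hδ1
    | succ i ih =>
      intro hi
      calc edist (v (i + 1)) a ^ p ≤ (edist (v i) a + edist (v (i + 1)) (v i)) ^ p := by
            gcongr
            exact (edist_triangle _ (v i) _).trans_eq (add_comm _ _)
        _ ≤ q * edist (v i) a ^ p + (1 + δ⁻¹) ^ p * edist (v (i + 1)) (v i) ^ p :=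
            ENNReal.add_rpow_le hp0.le _ _ hδ hδ'
        _ ≤ q * (D * (q ^ i * H 0 + ∑ k ∈ Finset.range i, q ^ (i - k) * H k)) +
            (1 + δ⁻¹) ^ p * (C * H i) := by
            gcongr
            · exact ih (by omega)
            · exact hstep i (by omega)
        _ = D * (q ^ (i + 1) * H 0 +
            ((∑ k ∈ Finset.range i, q ^ (i + 1 - k) * H k) + H i)) := by
            have : ∑ k ∈ Finset.range i, q ^ (i + 1 - k) * H k =
                q * ∑ k ∈ Finset.range i, q ^ (i - k) * H k := by
              rw [Finset.mul_sum]
              refine Finset.sum_congr rfl fun k hk => ?_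
              rw [Nat.succ_sub (Finset.mem_range.1 hk).le, pow_succ]
              ring
            rw [this, hD]
            ring
        _ ≤ _ := by
            rw [Finset.sum_range_succ]
            gcongr
            rw [Nat.add_sub_cancel_left, pow_one]
            exact le_mul_of_one_le_left' hq1
  refine (key j le_rfl).trans ?_
  rw [mul_comm 2 D, mul_assoc D, two_mul]
  refine mul_le_mul_right (add_le_add ?_ ?_) D
  · exact Finset.single_le_sum (f := fun k => q ^ (j - k) * H k) (fun _ _ => zero_le)
      (Finset.mem_range.2 (Nat.succ_pos j))
  · exact Finset.sum_le_sum_of_subset (Finset.range_mono (Nat.le_succ j))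

theorem ENNReal.rpow_le_of_le_mul_rpow_inv {p : ℝ} (hp : 0 < p) {e B Q : ℝ≥0∞}
    (h : e ≤ B * Q ^ p⁻¹) : e ^ p ≤ B ^ p * Q := by
  calc e ^ p ≤ (B * Q ^ p⁻¹) ^ p := by gcongr
    _ = _ := by rw [ENNReal.mul_rpow_of_nonneg _ _ hp.le, ENNReal.rpow_inv_rpow hp.ne']

namespace HasPoincareUpTo

variable {X : Type*} [MetricSpace X] [MeasurableSpace X] [BorelSpace X] {m : Measure X}
  [IsLocallyFiniteMeasure m] [m.IsOpenPosMeasure] {A c p P R : ℝ} {K : ℝ≥0∞} {U : Set X}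
  {f : X → ℝ} {Γ : Measure X}

/-- The average over a small ball whose distance to the boundary is of order `τ ^ j * R` is
compared with the average over a central ball along a chain of corkscrew points. -/
theorem edist_average_central_rpow_le (hf : HasPoincareUpTo m f Γ p P R K)
    (hU : IsUniformDomain A U) (hm : VolumeDoubling m c) (hp : 1 ≤ p) (hA : 1 ≤ A) (hP : 1 ≤ P)
    (hR0 : 0 < R) (hR : ∀ y ∈ U, ∃ w ∈ U, R ≤ dist y w) {τ κ : ℝ} (hτ : τ = 1 / (8 * A))
    (hκ : 0 < κ) (hκθ : 8 * A * P * κ ≤ τ ^ 2) {n : ℕ} (hn : 22 * A ≤ 2 ^ n * (κ * τ))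
    {x x₀ : X} (hx₀ : x₀ ∈ U) (hxx₀ : dist x x₀ = R / 2)
    (hdx₀ : R / (2 * A) ≤ Metric.infDist x₀ Uᶜ) {y : X} (hy : y ∈ U) (hyx : dist y x ≤ 4 * R)
    {j : ℕ} (hyj : τ * (τ ^ j * R) ≤ Metric.infDist y Uᶜ) {δ : ℝ≥0∞} (hδ : δ ≠ 0)
    (hδ' : δ ≠ ∞) :
    edist (⨍ w in Metric.ball y (κ * (τ ^ j * R)), f w ∂m)
        (⨍ w in Metric.ball x₀ (κ * R), f w ∂m) ^ p ≤
      2 * (((4 * ENNReal.ofReal c ^ n + 2) ^ p * ENNReal.ofReal c ^ n) * (1 + δ⁻¹) ^ p) *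
        ∑ k ∈ Finset.range (j + 1), ((1 + δ) ^ p) ^ (j - k) *
          (K * (Γ (deepBall U A (τ ^ 2) (τ ^ k * R) y) /
            m (Metric.ball y (7 * A * (τ ^ k * R))))) := by
  classical
  have hA0 : 0 < A := by linarith
  have hp0 : 0 < p := by linarith
  have hτ0 : 0 < τ := by rw [hτ]; positivity
  have hτ8 : τ ≤ 1 / 8 := by
    rw [hτ]; gcongr; linarith
  have hτ1 : τ ≤ 1 := by linarith
  have hθ0 : 0 < τ ^ 2 := by positivity
  have hθ1 : τ ^ 2 ≤ 1 := pow_le_one₀ hτ0.le hτ1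
  have hs : ∀ k, 0 < τ ^ k * R := fun k => by positivity
  have hsR : ∀ k, τ ^ k * R ≤ R := fun k =>
    mul_le_of_le_one_left hR0.le (pow_le_one₀ hτ0.le hτ1)
  have hssucc : ∀ k, τ ^ (k + 1) * R ≤ τ ^ k * R := fun k => by
    have := pow_le_pow_of_le_one hτ0.le hτ1 (Nat.le_succ k)
    gcongr
  have hcork : ∀ s, s / (2 * A) = 4 * τ * s := fun s => by rw [hτ]; field_simp; ring
  have hn' : 22 * A ≤ 2 ^ n * κ := hn.trans (by
    have : κ * τ ≤ κ := mul_le_of_le_one_right hκ.le hτ1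
    gcongr)
  have hκτ : ∀ k, 14 * A * (τ ^ k * R) ≤ 2 ^ n * (κ * (τ ^ (k + 1) * R)) := fun k => by
    have := mul_le_mul_of_nonneg_right hn (hs k).le
    have h2 : 2 ^ n * (κ * τ) * (τ ^ k * R) = 2 ^ n * (κ * (τ ^ (k + 1) * R)) := by ring
    have h3 : 0 < A * (τ ^ k * R) := mul_pos hA0 (hs k)
    linarith
  have hκτ' : ∀ k, 14 * A * (τ ^ k * R) ≤ 2 ^ n * (κ * (τ ^ k * R)) := fun k => by
    have := mul_le_mul_of_nonneg_right hn' (hs k).le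
    have h3 : 0 < A * (τ ^ k * R) := mul_pos hA0 (hs k)
    linarith
  have hex : ∀ k, ∃ a ∈ U, dist y a = τ ^ k * R / 2 ∧
      τ ^ k * R / (2 * A) ≤ Metric.infDist a Uᶜ := fun k => by
    obtain ⟨w, hw, hyw⟩ := hR y hy
    exact hU.exists_corkscrew hA hy hw (hs k) ((hsR k).trans hyw)
  choose a₀ ha₀U ha₀y ha₀d using hex
  -- Corkscrew points of `y` at all scales coarser than `j`, then `y` itself, which is already deep
  -- enough at scale `j`.
  set a : ℕ → X := fun k => if k < j then a₀ k else y with ha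
  have haj : a j = y := by simp [ha]
  have haU : ∀ k, a k ∈ U := fun k => by
    simp only [ha]; split_ifs
    exacts [ha₀U k, hy]
  have hay : ∀ k, dist (a k) y ≤ τ ^ k * R / 2 := fun k => by
    simp only [ha]; split_ifs
    · rw [dist_comm, ha₀y]
    · rw [dist_self]; have := hs k; positivity
  have had : ∀ k ≤ j, τ * (τ ^ k * R) ≤ Metric.infDist (a k) Uᶜ := fun k hk => by
    simp only [ha]; split_ifs with h
    · have := ha₀d k
      rw [hcork] at this
      nlinarith [mul_pos hτ0 (hs k)]
    · rwa [(by omega : k = j)]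
  have had' : ∀ k ≤ j, τ ^ 2 * (τ ^ k * R) ≤ Metric.infDist (a k) Uᶜ := fun k hk => by
    refine le_trans ?_ (had k hk)
    rw [sq, mul_assoc]
    exact mul_le_of_le_one_left (mul_pos hτ0 (hs k)).le hτ1
  -- One constant serves every jump: `4 * c ^ n` for moving the centre along a chain, `2` for
  -- shrinking the radius.
  have hQ : ∀ B Q : ℝ≥0∞, ∀ e : ℝ≥0∞, e ≤ B * (ENNReal.ofReal c ^ n * Q) ^ p⁻¹ →
      B ≤ 4 * ENNReal.ofReal c ^ n + 2 →
      e ^ p ≤ (4 * ENNReal.ofReal c ^ n + 2) ^ p * ENNReal.ofReal c ^ n * Q := by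
    intro B Q e h hB
    refine (ENNReal.rpow_le_of_le_mul_rpow_inv hp0 h).trans ?_
    rw [mul_assoc]
    gcongr
  have hmain := edist_rpow_le_sum_geometric
    (v := fun k => ⨍ w in Metric.ball (a k) (κ * (τ ^ k * R)), f w ∂m)
    (a := ⨍ w in Metric.ball x₀ (κ * R), f w ∂m) hp
    (C := (4 * ENNReal.ofReal c ^ n + 2) ^ p * ENNReal.ofReal c ^ n) hδ hδ'
    (H := fun k => K * (Γ (deepBall U A (τ ^ 2) (τ ^ k * R) y) /
      m (Metric.ball y (7 * A * (τ ^ k * R))))) (j := j) ?_ ?_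
  · simpa only [haj] using hmain
  · have h0 : τ ^ 0 * R = R := by simp
    refine hQ _ _ _ ?_ le_self_add
    have hd0 := had' 0 (Nat.zero_le j)
    have hy0 := hay 0
    simp only [h0] at hd0 hy0 ⊢
    -- The distance bound `5 * R` is `R / 2 + 4 * R + R / 2`, through `y` and `x`.
    refine hf.edist_average_chain_le hU hm hp hA hP hκ hκθ hθ0 hθ1 hR0 le_rfl hn' (haU 0) hx₀
      (by linarith) ?_ hd0 ?_
    · have h1 := dist_triangle (a 0) y x₀
      have h2 := dist_triangle y x x₀
      linarith
    · rw [hcork] at hdx₀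
      nlinarith [mul_pos hτ0 hR0]
  · intro k hk
    have hsk := hs k
    have hsk1 := hssucc k
    have hd1 : τ ^ 2 * (τ ^ k * R) ≤ Metric.infDist (a (k + 1)) Uᶜ := by
      refine le_trans (le_of_eq ?_) (had (k + 1) hk)
      ring
    have hayk := hay k
    have hayk1 := hay (k + 1)
    rw [edist_comm]
    refine hQ (4 * ENNReal.ofReal c ^ n + 2) _ _ ?_ le_rfl
    rw [add_mul]
    -- First move the centre to `a (k + 1)` at the old radius, then shrink the ball. The new centre
    -- has depth at least `τ ^ 2` times the old scale, whence `θ = τ ^ 2`.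
    refine (edist_triangle _ (⨍ w in Metric.ball (a (k + 1)) (κ * (τ ^ k * R)), f w ∂m) _).trans
      (add_le_add ?_ ?_)
    · refine hf.edist_average_chain_le hU hm hp hA hP hκ hκθ hθ0 hθ1 hsk (hsR k) hn' (haU k)
        (haU _) (by linarith) ?_ (had' k hk.le) hd1
      have := dist_triangle_right (a k) (a (k + 1)) y
      linarith
    · have hκs : 0 < κ * (τ ^ k * R) := mul_pos hκ hsk
      have hκs1 : κ * (τ ^ (k + 1) * R) ≤ κ * (τ ^ k * R) := by gcongr
      refine hf.edist_average_le hm hp hA hP hκ hκθ hθ1 hsk (hsR k) (z := a (k + 1)) hκs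
        (mul_pos hκ (hs _)) (hκτ' k) (hκτ k) ?_ (le_trans ?_ hd1)
        (Metric.ball_subset_ball (by linarith)) (Metric.ball_subset_ball (by linarith))
      · have : τ ^ k * R ≤ A * (τ ^ k * R) := le_mul_of_one_le_left hsk.le hA
        linarith
      · refine div_le_self (by positivity) (by linarith)

end HasPoincareUpTo

/-! ### Integration over the slices of comparable depth. -/

/-- The points of `U` within distance `4 * R` of `x` whose distance to the complement of `U` is
between `τ ^ (j + 1) * R` and `τ ^ j * R`, with no upper bound when `j = 0`. -/
def depthLayer {X : Type*} [MetricSpace X] (U : Set X) (τ R : ℝ) (x : X) (j : ℕ) : Set X :=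
  {y | y ∈ U ∧ dist y x ≤ 4 * R ∧ τ * (τ ^ j * R) ≤ Metric.infDist y Uᶜ ∧
    (j ≠ 0 → Metric.infDist y Uᶜ < τ ^ j * R)}

/-- The points within distance `12 * A * R` of `x` whose distance to the complement of `U` is
comparable with `τ ^ k * R`, with no upper bound when `k = 0`. -/
def depthBand {X : Type*} [MetricSpace X] (U : Set X) (A τ R : ℝ) (x : X) (k : ℕ) : Set X :=
  {v | dist v x < 12 * A * R ∧ τ ^ 2 / (4 * A) * (τ ^ k * R) ≤ Metric.infDist v Uᶜ ∧
    (k ≠ 0 → Metric.infDist v Uᶜ ≤ 8 * A * (τ ^ k * R))}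

theorem measurableSet_depthLayer {X : Type*} [MetricSpace X] [MeasurableSpace X] [BorelSpace X]
    {U : Set X} (hU : IsOpen U) (τ R : ℝ) (x : X) (j : ℕ) :
    MeasurableSet (depthLayer U τ R x j) := by
  have hd : Continuous fun v : X => Metric.infDist v Uᶜ := Metric.continuous_infDist_pt _
  have h1 : MeasurableSet {y | dist y x ≤ 4 * R} :=
    (isClosed_le (continuous_id.dist continuous_const) continuous_const).measurableSet
  have h2 : MeasurableSet {y | τ * (τ ^ j * R) ≤ Metric.infDist y Uᶜ} :=
    (isClosed_le continuous_const hd).measurableSet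
  have h3 : MeasurableSet {y | j ≠ 0 → Metric.infDist y Uᶜ < τ ^ j * R} :=
    MeasurableSet.imp (.const _) (isOpen_lt hd continuous_const).measurableSet
  exact hU.measurableSet.inter (h1.inter (h2.inter h3))

theorem measurableSet_depthBand {X : Type*} [MetricSpace X] [MeasurableSpace X] [BorelSpace X]
    (U : Set X) (A τ R : ℝ) (x : X) (k : ℕ) : MeasurableSet (depthBand U A τ R x k) := by
  have hd : Continuous fun v : X => Metric.infDist v Uᶜ := Metric.continuous_infDist_pt _
  have h1 : MeasurableSet {v | dist v x < 12 * A * R} :=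
    (isOpen_lt (continuous_id.dist continuous_const) continuous_const).measurableSet
  have h2 : MeasurableSet {v | τ ^ 2 / (4 * A) * (τ ^ k * R) ≤ Metric.infDist v Uᶜ} :=
    (isClosed_le continuous_const hd).measurableSet
  have h3 : MeasurableSet {v | k ≠ 0 → Metric.infDist v Uᶜ ≤ 8 * A * (τ ^ k * R)} :=
    MeasurableSet.imp (.const _) (isClosed_le hd continuous_const).measurableSet
  exact h1.inter (h2.inter h3)

namespace HasPoincareUpTo

variable {X : Type*} [MetricSpace X] [MeasurableSpace X] [BorelSpace X] {m : Measure X}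
  [IsLocallyFiniteMeasure m] [m.IsOpenPosMeasure] [SecondCountableTopology X]
  {A c p P R : ℝ} {K : ℝ≥0∞} {U : Set X} {f : X → ℝ} {Γ : Measure X}

/-- The averaged distance of `f` to its averages over balls of a fixed small radius. -/
theorem lintegral_average_edist_le [SFinite Γ] (hf : HasPoincareUpTo m f Γ p P R K)
    (hfm : Measurable f) (hm : VolumeDoubling m c) (hP : 1 ≤ P) {n : ℕ} (hn : P ≤ 2 ^ n)
    {ρ : ℝ} (hρ : 0 < ρ) (hρR : ρ ≤ R) {E S : Set X} (hE : MeasurableSet E) (hS : MeasurableSet S)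
    (hES : ∀ y ∈ E, Metric.ball y ((P + 1) * ρ) ⊆ S) :
    ∫⁻ y in E, (∫⁻ z in Metric.ball y ρ, edist (f y) (⨍ w in Metric.ball z ρ, f w ∂m) ^ p ∂m) /
        m (Metric.ball y ρ) ∂m ≤
      ENNReal.ofReal c * ENNReal.ofReal c ^ n * ENNReal.ofReal c * (K * Γ S) := by
  -- Every `z` seen from `E` lies in `L`, and for such `z` the ball `B(z, P * ρ)` is still inside
  -- `S`.
  set L := Metric.thickening ρ E with hL
  have hLm : MeasurableSet L := Metric.isOpen_thickening.measurableSet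
  have hF := measurable_setAverage_ball (m := m) hfm ρ
  have hφ : Measurable (Function.uncurry fun y z : X =>
      edist (f y) (⨍ w in Metric.ball z ρ, f w ∂m) ^ p) :=
    ((hfm.comp measurable_fst).edist (hF.comp measurable_snd)).pow_const p
  have hPρ : 0 < P * ρ := by positivity
  calc _ = ∫⁻ y in E, (∫⁻ z in Metric.ball y ρ ∩ L,
          edist (f y) (⨍ w in Metric.ball z ρ, f w ∂m) ^ p ∂m) / m (Metric.ball y ρ) ∂m := by
        refine setLIntegral_congr_fun hE fun y hy => ?_
        have : Metric.ball y ρ ∩ L = Metric.ball y ρ :=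
          inter_eq_left.2 (Metric.ball_subset_thickening hy ρ)
        simp only [this]
    _ ≤ ENNReal.ofReal c * ∫⁻ z in L, (∫⁻ y in Metric.ball z ρ ∩ E,
          edist (f y) (⨍ w in Metric.ball z ρ, f w ∂m) ^ p ∂m) / m (Metric.ball z ρ) ∂m :=
        hm.lintegral_ball_average_le hE hρ hφ
    _ ≤ ENNReal.ofReal c * ∫⁻ z in L, (K * ENNReal.ofReal c ^ n) *
          (Γ (Metric.ball z (P * ρ) ∩ S) / m (Metric.ball z (P * ρ))) ∂m := by
        refine mul_le_mul_right (setLIntegral_mono' hLm fun z hz => ?_) _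
        obtain ⟨y, hy, hzy⟩ := Metric.mem_thickening_iff.1 hz
        have hsub : Metric.ball z (P * ρ) ∩ S = Metric.ball z (P * ρ) :=
          inter_eq_left.2 ((Metric.ball_subset_ball' (by linarith)).trans (hES y hy))
        rw [hsub]
        have hinv : (m (Metric.ball z ρ))⁻¹ ≤
            ENNReal.ofReal c ^ n * (m (Metric.ball z (P * ρ)))⁻¹ :=
          ENNReal.inv_le_mul_inv_of_le_mul (Metric.measure_ball_pos m z hPρ).ne'
            (hm.measure_ball_lt_top _ _).ne (Metric.measure_ball_pos m z hρ).ne'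
            (hm.measure_ball_lt_top _ _).ne
            (hm.measure_ball_le hρ (by rw [dist_self, zero_add]; gcongr))
        calc _ ≤ K * Γ (Metric.ball z (P * ρ)) * (m (Metric.ball z ρ))⁻¹ := by
              rw [div_eq_mul_inv]
              gcongr
              exact (lintegral_mono_set inter_subset_left).trans (hf.lintegral_le z ρ hρ hρR)
          _ ≤ K * Γ (Metric.ball z (P * ρ)) *
              (ENNReal.ofReal c ^ n * (m (Metric.ball z (P * ρ)))⁻¹) := by gcongr
          _ = _ := by rw [div_eq_mul_inv]; ring
    -- A second use of Fubini, now between `m` and `Γ`, integrates the energy density to at most a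
    -- multiple of `Γ S`.
    _ ≤ ENNReal.ofReal c * (K * ENNReal.ofReal c ^ n * (ENNReal.ofReal c * (1 * Γ S))) := by
        have hQ : Measurable fun z =>
            Γ (Metric.ball z (P * ρ) ∩ S) / m (Metric.ball z (P * ρ)) :=
          (measurable_measure_ball_inter Γ hS _).div (measurable_measure_ball m _)
        rw [lintegral_const_mul _ hQ]
        gcongr
        exact hm.lintegral_measure_ball_div_le hLm hS hPρ fun z _ => by
          rw [one_mul]; exact measure_mono inter_subset_right
    _ = _ := by ring

/-- The weight `(1 + δ) ^ p` per scale comes from summing jumps along the chain, and the factor `M /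
(1 + M)` per scale from the small share of slice `j` in balls of radius about `τ ^ k * R`. Their
product governs the influence of band `k` on slice `j`. -/
theorem lintegral_depthLayer_le [SFinite Γ] (hf : HasPoincareUpTo m f Γ p P R K)
    (hfm : Measurable f) (hU : IsUniformDomain A U) (hm : VolumeDoubling m c) (hc : 1 ≤ c)
    (hp : 1 ≤ p) (hA : 1 ≤ A) (hP : 1 ≤ P)
    (hR0 : 0 < R) (hR : ∀ y ∈ U, ∃ w ∈ U, R ≤ dist y w) {τ κ : ℝ} (hτ : τ = 1 / (8 * A))
    (hκ : 0 < κ) (hκθ : 8 * A * P * κ ≤ τ ^ 2) {n : ℕ} (hn : 22 * A ≤ 2 ^ n * (κ * τ))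
    {x x₀ : X} (hx₀ : x₀ ∈ U) (hxx₀ : dist x x₀ = R / 2)
    (hdx₀ : R / (2 * A) ≤ Metric.infDist x₀ Uᶜ) {δ M T D : ℝ≥0∞} (hδ : δ ≠ 0)
    (hδ' : δ ≠ ∞) (hM : M = ENNReal.ofReal c ^ (n + 1)) (hT : T = 2 ^ (p - 1))
    (hD : D = 2 ^ p * ENNReal.ofReal c ^ n +
      2 * (((4 * ENNReal.ofReal c ^ n + 2) ^ p * ENNReal.ofReal c ^ n) * (1 + δ⁻¹) ^ p)) (j : ℕ) :
    ∫⁻ y in depthLayer U τ R x j, edist (f y) (⨍ w in Metric.ball x₀ (κ * R), f w ∂m) ^ p ∂m ≤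
      (T * (ENNReal.ofReal c * ENNReal.ofReal c ^ n * ENNReal.ofReal c) +
        T * (T * D) * (ENNReal.ofReal c * ENNReal.ofReal c)) *
      ∑ k ∈ Finset.range (j + 1), ((1 + δ) ^ p * (M / (1 + M))) ^ (j - k) *
        (K * Γ (depthBand U A τ R x k)) := by
  have hA0 : 0 < A := by linarith
  have hp0 : 0 < p := by linarith
  have hτ0 : 0 < τ := by rw [hτ]; positivity
  have hτ8 : τ ≤ 1 / 8 := by
    rw [hτ]; gcongr; linarith
  have hτ1 : τ ≤ 1 := by linarith
  have hθ1 : τ ^ 2 ≤ 1 := pow_le_one₀ hτ0.le hτ1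
  have hs : ∀ k, 0 < τ ^ k * R := fun k => by positivity
  have hsR : ∀ k, τ ^ k * R ≤ R := fun k =>
    mul_le_of_le_one_left hR0.le (pow_le_one₀ hτ0.le hτ1)
  have hsmono : ∀ k ≤ j, τ ^ j * R ≤ τ ^ k * R := fun k hk => by
    have := pow_le_pow_of_le_one hτ0.le hτ1 hk
    gcongr
  have hAs : ∀ k, τ ^ k * R ≤ A * (τ ^ k * R) := fun k => le_mul_of_one_le_left (hs k).le hA
  have hAsR : ∀ k, A * (τ ^ k * R) ≤ A * R := fun k => by gcongr; exact hsR k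
  have hAR : R ≤ A * R := le_mul_of_one_le_left hR0.le hA
  have hPκ : 8 * P * κ ≤ τ ^ 2 := by
    refine le_trans ?_ hκθ
    have : P * κ ≤ A * P * κ := by
      rw [mul_assoc]; exact le_mul_of_one_le_left (by positivity) hA
    linarith
  have hκP : κ ≤ P * κ := le_mul_of_one_le_left hκ.le hP
  have hκ1 : κ ≤ 1 := by linarith
  have hκτ : κ * τ ≤ 1 := mul_le_one₀ hκ1 hτ0.le hτ1
  have hn2 : 22 * A ≤ 2 ^ n * κ := hn.trans (by
    have : κ * τ ≤ κ := mul_le_of_le_one_right hκ.le hτ1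
    gcongr)
  have hn3 : 22 * A ≤ 2 ^ n := hn.trans (mul_le_of_le_one_right (by positivity) hκτ)
  have hnP : P ≤ 2 ^ n := by
    by_contra! h
    have : 2 ^ n * κ ≤ P * κ := by gcongr
    linarith
  set s := τ ^ j * R with hs_def
  set ρ := κ * s with hρ_def
  have hs0 : 0 < s := hs j
  have hρ : 0 < ρ := mul_pos hκ hs0
  set c₀ := ⨍ w in Metric.ball x₀ (κ * R), f w ∂m with hc₀
  set E := depthLayer U τ R x j with hE
  have hEm : MeasurableSet E := measurableSet_depthLayer hU.isOpen τ R x j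
  set S := fun k => depthBand U A τ R x k with hS
  have hSm : ∀ k, MeasurableSet (S k) := fun k => measurableSet_depthBand U A τ R x k
  have hdeep : ∀ y ∈ E, ∀ k ≤ j, deepBall U A (τ ^ 2) (τ ^ k * R) y ⊆
      Metric.ball y (7 * A * (τ ^ k * R)) ∩ S k := by
    rintro y ⟨hyU, hyx, hyd, hyd'⟩ k hk v ⟨hv, hvd⟩
    refine ⟨hv, ?_, hvd, fun hk0 => ?_⟩
    · have h1 := dist_triangle v y x
      have h2 := hAsR k
      rw [Metric.mem_ball] at hv
      linarith
    · have h1 := Metric.infDist_le_infDist_add_dist (s := Uᶜ) (x := v) (y := y)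
      have h2 := hyd' (by omega)
      have h3 := hsmono k hk
      have h4 := hAs k
      rw [Metric.mem_ball] at hv
      linarith
  set W := fun y => ∑ k ∈ Finset.range (j + 1), ((1 + δ) ^ p) ^ (j - k) *
    (K * (Γ (Metric.ball y (7 * A * (τ ^ k * R)) ∩ S k) / m (Metric.ball y (7 * A * (τ ^ k * R)))))
    with hW
  have hQm : ∀ k, Measurable fun y => Γ (Metric.ball y (7 * A * (τ ^ k * R)) ∩ S k) /
      m (Metric.ball y (7 * A * (τ ^ k * R))) := fun k =>
    (measurable_measure_ball_inter Γ (hSm k) _).div (measurable_measure_ball m _)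
  have hWm : Measurable W :=
    Finset.measurable_sum _ fun k _ => ((hQm k).const_mul K).const_mul _
  have hTadd : ∀ a b : ℝ≥0∞, (a + b) ^ p ≤ T * (a ^ p + b ^ p) := fun a b => by
    rw [hT]; exact ENNReal.rpow_add_le_mul_rpow_add_rpow a b hp
  -- The value `f y` is linked to the average about `y` through the average about a free nearby `z`.
  -- Averaging over `z` then allows Fubini to recover Poincaré integrals, with no covering of the
  -- slice.
  have hpoint : ∀ y ∈ E, ∀ z ∈ Metric.ball y ρ, edist (f y) c₀ ^ p ≤
      T * edist (f y) (⨍ w in Metric.ball z ρ, f w ∂m) ^ p + T * (T * D) * W y := by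
    intro y hy z hz
    have hyE := hy
    obtain ⟨hyU, hyx, hyd, -⟩ := hyE
    have h1 := hf.edist_average_central_rpow_le hU hm hp hA hP hR0 hR hτ hκ hκθ hn hx₀ hxx₀ hdx₀
      hyU hyx hyd hδ hδ'
    have h1' : edist (⨍ w in Metric.ball y ρ, f w ∂m) c₀ ^ p ≤
        2 * (((4 * ENNReal.ofReal c ^ n + 2) ^ p * ENNReal.ofReal c ^ n) *
          (1 + δ⁻¹) ^ p) * W y := by
      refine h1.trans (mul_le_mul_right (Finset.sum_le_sum fun k hk => ?_) _)
      gcongr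
      exact hdeep y hy k (by simpa [Nat.lt_succ_iff] using hk)
    have h2 : edist (⨍ w in Metric.ball z ρ, f w ∂m) (⨍ w in Metric.ball y ρ, f w ∂m) ≤
        2 * (ENNReal.ofReal c ^ n * (K * (Γ (deepBall U A (τ ^ 2) s y) /
          m (Metric.ball y (7 * A * s))))) ^ p⁻¹ := by
      have h14 : 14 * A * s ≤ 2 ^ n * ρ := by
        have := mul_le_mul_of_nonneg_right hn2 hs0.le
        have h3 : 0 < A * s := mul_pos hA0 hs0
        linarith
      refine hf.edist_average_le hm hp hA hP hκ hκθ hθ1 hs0 (hsR j) (z := y) hρ hρ h14 h14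
        (by rw [dist_self]; positivity) ?_ (Metric.ball_subset_ball' ?_)
        (Metric.ball_subset_ball (by linarith))
      · refine le_trans (div_le_self (by positivity) (by linarith)) (le_trans ?_ hyd)
        rw [sq, mul_assoc]
        exact mul_le_of_le_one_left (by positivity) hτ1
      · rw [Metric.mem_ball] at hz
        linarith
    have h2' : edist (⨍ w in Metric.ball z ρ, f w ∂m) (⨍ w in Metric.ball y ρ, f w ∂m) ^ p ≤
        2 ^ p * ENNReal.ofReal c ^ n * W y := by
      refine (ENNReal.rpow_le_of_le_mul_rpow_inv hp0 h2).trans ?_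
      refine (mul_assoc _ _ _).symm.le.trans (mul_le_mul_right ?_ _)
      refine le_trans ?_ (Finset.single_le_sum (fun _ _ => zero_le)
        (Finset.mem_range.2 (Nat.lt_succ_self j)))
      rw [Nat.sub_self, pow_zero, one_mul]
      gcongr
      exact hdeep y hy j le_rfl
    calc edist (f y) c₀ ^ p
        ≤ (edist (f y) (⨍ w in Metric.ball z ρ, f w ∂m) +
          (edist (⨍ w in Metric.ball z ρ, f w ∂m) (⨍ w in Metric.ball y ρ, f w ∂m) +
            edist (⨍ w in Metric.ball y ρ, f w ∂m) c₀)) ^ p := by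
          gcongr
          exact (edist_triangle _ _ _).trans (add_le_add_right (edist_triangle _ _ _) _)
      _ ≤ T * (edist (f y) (⨍ w in Metric.ball z ρ, f w ∂m) ^ p + T * (
          edist (⨍ w in Metric.ball z ρ, f w ∂m) (⨍ w in Metric.ball y ρ, f w ∂m) ^ p +
            edist (⨍ w in Metric.ball y ρ, f w ∂m) c₀ ^ p)) := by
          refine (hTadd _ _).trans ?_
          gcongr
          exact hTadd _ _
      _ ≤ T * (edist (f y) (⨍ w in Metric.ball z ρ, f w ∂m) ^ p + T * (
          2 ^ p * ENNReal.ofReal c ^ n * W y + 2 * (((4 * ENNReal.ofReal c ^ n + 2) ^ p *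
        ENNReal.ofReal c ^ n) * (1 + δ⁻¹) ^ p) * W y)) := by gcongr
      _ = _ := by rw [hD]; ring
  have haver : ∀ y ∈ E, edist (f y) c₀ ^ p ≤
      T * ((∫⁻ z in Metric.ball y ρ, edist (f y) (⨍ w in Metric.ball z ρ, f w ∂m) ^ p ∂m) /
        m (Metric.ball y ρ)) + T * (T * D) * W y := by
    intro y hy
    have hb0 : m (Metric.ball y ρ) ≠ 0 := (Metric.measure_ball_pos m y hρ).ne'
    have hbtop := (hm.measure_ball_lt_top y ρ).ne
    have h1 : edist (f y) c₀ ^ p * m (Metric.ball y ρ) ≤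
        T * (∫⁻ z in Metric.ball y ρ, edist (f y) (⨍ w in Metric.ball z ρ, f w ∂m) ^ p ∂m) +
        T * (T * D) * W y * m (Metric.ball y ρ) := by
      calc _ = ∫⁻ z in Metric.ball y ρ, edist (f y) c₀ ^ p ∂m := by simp
        _ ≤ ∫⁻ z in Metric.ball y ρ, (T * edist (f y) (⨍ w in Metric.ball z ρ, f w ∂m) ^ p +
            T * (T * D) * W y) ∂m :=
          setLIntegral_mono' Metric.isOpen_ball.measurableSet (hpoint y hy)
        _ = _ := by
          rw [lintegral_add_right _ measurable_const, lintegral_const_mul _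
            ((measurable_const.edist (measurable_setAverage_ball hfm ρ)).pow_const p)]
          simp
    rw [← ENNReal.le_div_iff_mul_le (Or.inl hb0) (Or.inl hbtop)] at h1
    refine h1.trans (le_of_eq ?_)
    rw [ENNReal.add_div, mul_div_assoc, ENNReal.mul_div_cancel_right hb0 hbtop]
  have hlocal := hf.lintegral_average_edist_le hfm hm hP hnP hρ
    (by have := hsR j; nlinarith) hEm (hSm j) (fun y hy => by
      refine Subset.trans (fun v hv => ?_) ((hdeep y hy j le_rfl).trans inter_subset_right)
      have hρs : (P + 1) * ρ ≤ τ ^ 2 / 4 * s := by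
        have : 2 * P * κ * s ≤ τ ^ 2 / 4 * s := by gcongr; linarith
        have : κ * s ≤ P * κ * s := by gcongr
        rw [hρ_def]
        linarith
      have hθs : τ ^ 2 * s ≤ τ * s := by
        rw [sq, mul_assoc]
        exact mul_le_of_le_one_left (by positivity) hτ1
      have hτs : τ * s ≤ s := mul_le_of_le_one_left hs0.le hτ1
      rw [Metric.mem_ball] at hv
      constructor
      · rw [Metric.mem_ball]
        have := hAs j
        linarith
      · have h1 := Metric.infDist_le_infDist_add_dist (s := Uᶜ) (x := y) (y := v)
        rw [dist_comm y v] at h1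
        have h2 := hy.2.2.1
        have h3 : τ ^ 2 / (4 * A) * s ≤ τ ^ 2 / 4 * s := by gcongr; linarith
        change τ ^ 2 / (4 * A) * s ≤ _
        linarith [mul_pos hτ0 hs0])
  have hchain : ∀ k ≤ j, ∫⁻ y in E, Γ (Metric.ball y (7 * A * (τ ^ k * R)) ∩ S k) /
      m (Metric.ball y (7 * A * (τ ^ k * R))) ∂m ≤
      ENNReal.ofReal c * (ENNReal.ofReal c * (M / (1 + M)) ^ (j - k) * Γ (S k)) := by
    intro k hk
    have hsk := hs k
    refine hm.lintegral_measure_ball_div_le hEm (hSm k) (by positivity) fun z _ => ?_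
    have hc1 : 1 ≤ ENNReal.ofReal c := by simpa using hc
    -- At `k = j` no decay is needed, which also covers slice `0`, where depth is unbounded above.
    -- For `k < j` the slice lies in a boundary layer `j - k` scales thinner than `τ ^ k * R`.
    rcases hk.eq_or_lt with rfl | hkj
    · rw [Nat.sub_self, pow_zero, mul_one]
      exact (measure_mono inter_subset_right).trans (le_mul_of_one_le_left' hc1)
    · have hsub : E ⊆ boundaryLayer U ((1 / (8 * A)) ^ (j - k) * (τ ^ k * R)) := fun y hy => by
        refine ⟨hy.1, (hy.2.2.2 (by omega)).trans_eq ?_⟩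
        rw [← hτ, ← mul_assoc, ← pow_add, Nat.sub_add_cancel hk]
      calc m (E ∩ Metric.ball z (7 * A * (τ ^ k * R)))
          ≤ m (boundaryLayer U ((1 / (8 * A)) ^ (j - k) * (τ ^ k * R)) ∩
            Metric.ball z (7 * A * (τ ^ k * R))) := by gcongr
        _ ≤ (M / (1 + M)) ^ (j - k) * m (boundaryLayer U (τ ^ k * R) ∩
            Metric.ball z (7 * A * (τ ^ k * R) + 2 * (τ ^ k * R))) :=
          hU.measure_boundaryLayer_le hA hm hR (by linarith) hM _ hsk
            (by have := hsR k; linarith) z _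
        _ ≤ (M / (1 + M)) ^ (j - k) *
            (ENNReal.ofReal c * m (Metric.ball z (7 * A * (τ ^ k * R)))) := by
          gcongr
          have := hm.measure_ball_le (n := 1) (x := z) (y := z) (r := 7 * A * (τ ^ k * R))
            (s := 7 * A * (τ ^ k * R) + 2 * (τ ^ k * R)) (by positivity) (by
              rw [dist_self]
              have := hAs k
              linarith)
          rw [pow_one] at this
          exact (measure_mono inter_subset_right).trans this
        _ = _ := by ring
  have hWint : ∫⁻ y in E, W y ∂m ≤ (ENNReal.ofReal c * ENNReal.ofReal c) *
      ∑ k ∈ Finset.range (j + 1), ((1 + δ) ^ p * (M / (1 + M))) ^ (j - k) * (K * Γ (S k)) := by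
    rw [hW, lintegral_finsetSum _ fun k _ => ((hQm k).const_mul K).const_mul _, Finset.mul_sum]
    refine Finset.sum_le_sum fun k hk => ?_
    rw [lintegral_const_mul _ ((hQm k).const_mul K), lintegral_const_mul _ (hQm k), mul_pow]
    refine (mul_le_mul_right (mul_le_mul_right
      (hchain k (by simpa [Nat.lt_succ_iff] using hk)) _) _).trans (le_of_eq ?_)
    ring
  have hlast : K * Γ (S j) ≤
      ∑ k ∈ Finset.range (j + 1), ((1 + δ) ^ p * (M / (1 + M))) ^ (j - k) * (K * Γ (S k)) := by
    refine le_trans ?_ (Finset.single_le_sum (fun _ _ => zero_le)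
      (Finset.mem_range.2 (Nat.lt_succ_self j)))
    rw [Nat.sub_self, pow_zero, one_mul]
  calc ∫⁻ y in E, edist (f y) c₀ ^ p ∂m
      ≤ ∫⁻ y in E, (T * ((∫⁻ z in Metric.ball y ρ,
        edist (f y) (⨍ w in Metric.ball z ρ, f w ∂m) ^ p ∂m) /
        m (Metric.ball y ρ)) + T * (T * D) * W y) ∂m := setLIntegral_mono' hEm haver
    _ = T * (∫⁻ y in E, (∫⁻ z in Metric.ball y ρ,
        edist (f y) (⨍ w in Metric.ball z ρ, f w ∂m) ^ p ∂m) /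
        m (Metric.ball y ρ) ∂m) + T * (T * D) * ∫⁻ y in E, W y ∂m := by
      have hT' : T ≠ ∞ := by
        rw [hT]; exact ENNReal.rpow_ne_top_of_nonneg (by linarith) (by simp)
      rw [lintegral_add_right _ (hWm.const_mul _), lintegral_const_mul _ hWm,
        lintegral_const_mul' _ _ hT']
    _ ≤ T * (ENNReal.ofReal c * ENNReal.ofReal c ^ n * ENNReal.ofReal c * (K * Γ (S j))) +
        T * (T * D) * ((ENNReal.ofReal c * ENNReal.ofReal c) *
      ∑ k ∈ Finset.range (j + 1), ((1 + δ) ^ p * (M / (1 + M))) ^ (j - k) * (K * Γ (S k))) := by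
      gcongr
    _ ≤ _ := (add_le_add_left (mul_le_mul_right (mul_le_mul_right hlast _) _) _).trans
      (le_of_eq (by ring))

end HasPoincareUpTo

/-! ### Summation over all slices. -/

/-- The bands of comparable depth overlap boundedly often. -/
theorem sum_measure_depthBand_le {X : Type*} [MetricSpace X] [MeasurableSpace X] [BorelSpace X]
    (Γ : Measure X) {U : Set X} {A τ R : ℝ} (hA : 1 ≤ A) (hτ0 : 0 < τ) (hτ1 : τ ≤ 1) (hR : 0 < R)
    {N : ℕ} (hN : τ ^ N * (8 * A) < τ ^ 2 / (4 * A)) (x : X) (J : ℕ) :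
    ∑ k ∈ Finset.range (J + 1), Γ (depthBand U A τ R x k) ≤
      N * Γ {v | dist v x < 12 * A * R ∧ τ ^ 2 / (4 * A) * (τ ^ J * R) ≤ Metric.infDist v Uᶜ} := by
  classical
  set S := {v | dist v x < 12 * A * R ∧ τ ^ 2 / (4 * A) * (τ ^ J * R) ≤ Metric.infDist v Uᶜ} with hS
  have hSm : MeasurableSet S := by
    have h1 : MeasurableSet {v | dist v x < 12 * A * R} :=
      (isOpen_lt (continuous_id.dist continuous_const) continuous_const).measurableSet
    have h2 : MeasurableSet {v | τ ^ 2 / (4 * A) * (τ ^ J * R) ≤ Metric.infDist v Uᶜ} :=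
      (isClosed_le continuous_const (Metric.continuous_infDist_pt _)).measurableSet
    exact h1.inter h2
  have hBm : ∀ k, MeasurableSet (depthBand U A τ R x k) := measurableSet_depthBand U A τ R x
  have hcount : ∀ v, ∑ k ∈ Finset.range (J + 1),
      (depthBand U A τ R x k).indicator (1 : X → ℝ≥0∞) v ≤ S.indicator (fun _ => (N : ℝ≥0∞)) v := by
    intro v
    have hsum : ∑ k ∈ Finset.range (J + 1), (depthBand U A τ R x k).indicator (1 : X → ℝ≥0∞) v =
        (((Finset.range (J + 1)).filter fun k => v ∈ depthBand U A τ R x k).card : ℝ≥0∞) := by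
      simp [indicator]
    rw [hsum]
    set F := (Finset.range (J + 1)).filter fun k => v ∈ depthBand U A τ R x k with hF
    rcases F.eq_empty_or_nonempty with h | h
    · simp [h]
    have hmin := F.min'_mem h
    set k₀ := F.min' h with hk₀
    obtain ⟨hk₀J, hk₀v⟩ := Finset.mem_filter.1 hmin
    rw [Finset.mem_range] at hk₀J
    have hvS : v ∈ S := by
      refine ⟨hk₀v.1, le_trans ?_ hk₀v.2.1⟩
      have := pow_le_pow_of_le_one hτ0.le hτ1 (Nat.lt_succ_iff.1 hk₀J)
      gcongr
    rw [indicator_of_mem hvS]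
    -- The lower depth bound of the first band containing `v` excludes the upper bound of any band
    -- `N` or more scales later.
    have hsub : F ⊆ Finset.Ico k₀ (k₀ + N) := by
      intro k hk
      rw [Finset.mem_Ico]
      refine ⟨F.min'_le k hk, ?_⟩
      by_contra! hlt
      have hkv := (Finset.mem_filter.1 hk).2
      -- Band `0` has no upper depth bound; it could violate the count only if `N = 0`, which `hN`
      -- forbids.
      rcases Nat.eq_zero_or_pos k with hk0 | hk0
      · have hN0 : N = 0 := by omega
        rw [hN0, pow_zero, one_mul] at hN
        have h1 : τ ^ 2 / (4 * A) ≤ 1 := by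
          rw [div_le_one (by positivity)]
          have := pow_le_one₀ (n := 2) hτ0.le hτ1
          linarith
        linarith
      · have h1 := hkv.2.2 hk0.ne'
        have h2 := hk₀v.2.1
        have h3 : τ ^ k ≤ τ ^ (k₀ + N) := pow_le_pow_of_le_one hτ0.le hτ1 hlt
        have h4 : 8 * A * (τ ^ k * R) ≤ 8 * A * (τ ^ (k₀ + N) * R) := by gcongr
        have h5 : 8 * A * (τ ^ (k₀ + N) * R) = τ ^ N * (8 * A) * (τ ^ k₀ * R) := by ring
        have h6 : τ ^ N * (8 * A) * (τ ^ k₀ * R) < τ ^ 2 / (4 * A) * (τ ^ k₀ * R) := by gcongr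
        linarith
    have := Finset.card_le_card hsub
    rw [Nat.card_Ico, Nat.add_sub_cancel_left] at this
    exact_mod_cast this
  calc ∑ k ∈ Finset.range (J + 1), Γ (depthBand U A τ R x k)
      = ∑ k ∈ Finset.range (J + 1), ∫⁻ v, (depthBand U A τ R x k).indicator 1 v ∂Γ :=
        Finset.sum_congr rfl fun k _ => (lintegral_indicator_one (hBm k)).symm
    _ = ∫⁻ v, ∑ k ∈ Finset.range (J + 1), (depthBand U A τ R x k).indicator 1 v ∂Γ :=
        (lintegral_finsetSum _ fun k _ => measurable_one.indicator (hBm k)).symm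
    _ ≤ ∫⁻ v, S.indicator (fun _ => (N : ℝ≥0∞)) v ∂Γ := lintegral_mono hcount
    _ = _ := lintegral_indicator_const hSm _

theorem ENNReal.sum_geometric_convolution_le (r : ℝ≥0∞) (g : ℕ → ℝ≥0∞) (J : ℕ) :
    ∑ j ∈ Finset.range (J + 1), ∑ k ∈ Finset.range (j + 1), r ^ (j - k) * g k ≤
      (1 - r)⁻¹ * ∑ k ∈ Finset.range (J + 1), g k := by
  rw [Finset.sum_comm' (t' := Finset.range (J + 1)) (s' := fun k => Finset.Ico k (J + 1))
    (by intro j k; simp only [Finset.mem_range, Finset.mem_Ico]; omega), Finset.mul_sum]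
  refine Finset.sum_le_sum fun k _ => ?_
  rw [← Finset.sum_mul, Finset.sum_Ico_eq_sum_range, ← ENNReal.tsum_geometric]
  gcongr
  simp only [Nat.add_sub_cancel_left]
  exact ENNReal.sum_le_tsum _

/-- Pick `l < b < 1` and solve `(1 + δ) ^ p = b⁻¹`. -/
theorem ENNReal.exists_one_add_rpow_mul_lt_one {p : ℝ} (hp : 0 < p) {l : ℝ≥0∞} (hl : l < 1) :
    ∃ δ : ℝ≥0∞, δ ≠ 0 ∧ δ ≠ ∞ ∧ (1 + δ) ^ p * l < 1 := by
  obtain ⟨b, hlb, hb1⟩ := exists_between hl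
  have hb0 : b ≠ 0 := (zero_le.trans_lt hlb).ne'
  have h1 : 1 < (b⁻¹) ^ p⁻¹ := ENNReal.one_lt_rpow (ENNReal.one_lt_inv.2 hb1) (by positivity)
  refine ⟨(b⁻¹) ^ p⁻¹ - 1, (tsub_pos_of_lt h1).ne', ?_, ?_⟩
  · exact ENNReal.sub_ne_top (ENNReal.rpow_ne_top_of_nonneg (by positivity)
      (ENNReal.inv_ne_top.2 hb0))
  · rw [add_tsub_cancel_of_le h1.le, ENNReal.rpow_inv_rpow hp.ne', mul_comm, ← div_eq_mul_inv]
    exact ENNReal.div_lt_of_lt_mul (by rwa [one_mul])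

theorem lintegral_biUnion_finset_le_sum {X ι : Type*} [MeasurableSpace X] {m : Measure X}
    (s : Finset ι) (t : ι → Set X) (f : X → ℝ≥0∞) :
    ∫⁻ y in ⋃ i ∈ s, t i, f y ∂m ≤ ∑ i ∈ s, ∫⁻ y in t i, f y ∂m := by
  classical
  induction s using Finset.induction_on with
  | empty => simp
  | insert i s hi ih =>
    rw [Finset.set_biUnion_insert, Finset.sum_insert hi]
    exact (lintegral_union_le _ _ _).trans (add_le_add_right ih _)

universe u

/-- The Poincaré inequality on the part of a uniform domain away from the boundary, with a constant
that does not depend on the distance to the boundary. -/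
theorem exists_lintegral_edist_central_average_le (p c A P : ℝ) (hp : 1 ≤ p) (hc : 1 ≤ c)
    (hA : 1 ≤ A) (hP : 1 ≤ P) : ∃ (τ κ : ℝ) (B : ℝ≥0∞), 0 < τ ∧ τ = 1 / (8 * A) ∧ 0 < κ ∧
      κ ≤ τ ∧ B ≠ ∞ ∧
      ∀ (X : Type u) [MetricSpace X] [MeasurableSpace X] [BorelSpace X] [SecondCountableTopology X]
        (m : Measure X) [IsLocallyFiniteMeasure m] [m.IsOpenPosMeasure] (Γ : Measure X) [SFinite Γ]
        (f : X → ℝ) (R : ℝ) (K : ℝ≥0∞) (U : Set X) (x x₀ : X) (J : ℕ), Measurable f →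
        HasPoincareUpTo m f Γ p P R K → IsUniformDomain A U → VolumeDoubling m c → 0 < R →
        (∀ y ∈ U, ∃ w ∈ U, R ≤ dist y w) → x₀ ∈ U → dist x x₀ = R / 2 →
        R / (2 * A) ≤ Metric.infDist x₀ Uᶜ →
        ∫⁻ y in {y | y ∈ U ∧ dist y x ≤ 4 * R ∧ τ * (τ ^ J * R) ≤ Metric.infDist y Uᶜ},
          edist (f y) (⨍ w in Metric.ball x₀ (κ * R), f w ∂m) ^ p ∂m ≤
        B * (K * Γ {v | dist v x < 12 * A * R ∧
          τ ^ 2 / (4 * A) * (τ ^ J * R) ≤ Metric.infDist v Uᶜ}) := by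
  have hp0 : 0 < p := by linarith
  set τ : ℝ := 1 / (8 * A) with hτ
  have hτ0 : 0 < τ := by positivity
  have hτ8 : τ ≤ 1 / 8 := by
    rw [hτ]; gcongr; linarith
  have hτ1 : τ < 1 := by linarith
  -- The value giving equality in `8 * A * P * κ ≤ θ` for `θ = τ ^ 2`.
  set κ : ℝ := τ ^ 2 / (8 * A * P) with hκ
  have hAP : 1 ≤ A * P := one_le_mul_of_one_le_of_one_le hA hP
  have hκ0 : 0 < κ := by positivity
  have hκθ : 8 * A * P * κ ≤ τ ^ 2 := by rw [hκ, mul_div_cancel₀ _ (by positivity)]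
  have hκτ : κ ≤ τ := by
    refine (div_le_self (by positivity) (by linarith)).trans ?_
    rw [sq]
    exact mul_le_of_le_one_left hτ0.le hτ1.le
  obtain ⟨n, hn⟩ := pow_unbounded_of_one_lt (22 * A / (κ * τ)) (one_lt_two (α := ℝ))
  rw [div_lt_iff₀ (by positivity)] at hn
  obtain ⟨N, hN⟩ := exists_pow_lt_of_lt_one (y := τ)
    (show 0 < τ ^ 2 / (4 * A) / (8 * A) by positivity) hτ1
  rw [lt_div_iff₀ (by positivity)] at hN
  set C := ENNReal.ofReal c with hC
  have hCtop : C ≠ ∞ := ENNReal.ofReal_ne_top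
  have hCn : C ^ n ≠ ∞ := ENNReal.pow_ne_top hCtop
  set M := C ^ (n + 1) with hM
  have hMtop : M ≠ ∞ := ENNReal.pow_ne_top hCtop
  have hl : M / (1 + M) < 1 := by
    refine ENNReal.div_lt_of_lt_mul ?_
    rw [one_mul, add_comm]
    exact ENNReal.lt_add_right hMtop one_ne_zero
  obtain ⟨δ, hδ, hδ', hr⟩ := ENNReal.exists_one_add_rpow_mul_lt_one hp0 hl
  set r := (1 + δ) ^ p * (M / (1 + M)) with hr_def
  set T : ℝ≥0∞ := 2 ^ (p - 1) with hT
  have hTtop : T ≠ ∞ := ENNReal.rpow_ne_top_of_nonneg (by linarith) (by simp)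
  set D := 2 ^ p * C ^ n + 2 * (((4 * C ^ n + 2) ^ p * C ^ n) * (1 + δ⁻¹) ^ p) with hD
  have hDtop : D ≠ ∞ := by
    have h1 : (2 : ℝ≥0∞) ^ p ≠ ∞ := ENNReal.rpow_ne_top_of_nonneg hp0.le (by simp)
    have h2 : (4 * C ^ n + 2) ^ p ≠ ∞ := ENNReal.rpow_ne_top_of_nonneg hp0.le
      (ENNReal.add_ne_top.2 ⟨ENNReal.mul_ne_top (by simp) hCn, by simp⟩)
    have h3 : (1 + δ⁻¹) ^ p ≠ ∞ := ENNReal.rpow_ne_top_of_nonneg hp0.le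
      (ENNReal.add_ne_top.2 ⟨by simp, ENNReal.inv_ne_top.2 hδ⟩)
    exact ENNReal.add_ne_top.2 ⟨ENNReal.mul_ne_top h1 hCn, ENNReal.mul_ne_top (by simp)
      (ENNReal.mul_ne_top (ENNReal.mul_ne_top h2 hCn) h3)⟩
  set B₀ := T * (C * C ^ n * C) + T * (T * D) * (C * C) with hB₀
  have hB₀top : B₀ ≠ ∞ := ENNReal.add_ne_top.2 ⟨ENNReal.mul_ne_top hTtop
    (ENNReal.mul_ne_top (ENNReal.mul_ne_top hCtop hCn) hCtop), ENNReal.mul_ne_top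
    (ENNReal.mul_ne_top hTtop (ENNReal.mul_ne_top hTtop hDtop)) (ENNReal.mul_ne_top hCtop hCtop)⟩
  have hrtop : (1 - r)⁻¹ ≠ ∞ := ENNReal.inv_ne_top.2 (tsub_pos_of_lt hr).ne'
  refine ⟨τ, κ, B₀ * ((1 - r)⁻¹ * N), hτ0, rfl, hκ0, hκτ, ENNReal.mul_ne_top hB₀top
    (ENNReal.mul_ne_top hrtop (by simp)), ?_⟩
  intro X _ _ _ _ m _ _ Γ _ f R K U x x₀ J hfm hf hU hm hR0 hR hx₀ hxx₀ hdx₀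
  set c₀ := ⨍ w in Metric.ball x₀ (κ * R), f w ∂m with hc₀
  -- A point belongs to the slice of the first `j` whose lower depth bound it meets; failure at `j -
  -- 1` is the upper bound.
  have hcover : {y | y ∈ U ∧ dist y x ≤ 4 * R ∧ τ * (τ ^ J * R) ≤ Metric.infDist y Uᶜ} ⊆
      ⋃ j ∈ Finset.range (J + 1), depthLayer U τ R x j := by
    rintro y ⟨hyU, hyx, hyd⟩
    have hex : ∃ j, τ * (τ ^ j * R) ≤ Metric.infDist y Uᶜ := ⟨J, hyd⟩
    classical
    refine mem_iUnion₂.2 ⟨Nat.find hex, Finset.mem_range.2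
      (Nat.lt_succ_of_le (Nat.find_min' hex hyd)), hyU, hyx, Nat.find_spec hex, fun h0 => ?_⟩
    have := Nat.find_min hex (m := Nat.find hex - 1) (by omega)
    rw [not_le] at this
    refine this.trans_eq ?_
    rw [← mul_assoc, ← pow_succ', Nat.sub_add_cancel (by omega)]
  calc _ ≤ ∫⁻ y in ⋃ j ∈ Finset.range (J + 1), depthLayer U τ R x j, edist (f y) c₀ ^ p ∂m :=
        lintegral_mono_set hcover
    _ ≤ ∑ j ∈ Finset.range (J + 1), ∫⁻ y in depthLayer U τ R x j, edist (f y) c₀ ^ p ∂m :=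
        lintegral_biUnion_finset_le_sum _ _ _
    _ ≤ ∑ j ∈ Finset.range (J + 1), B₀ * ∑ k ∈ Finset.range (j + 1), r ^ (j - k) *
          (K * Γ (depthBand U A τ R x k)) :=
        Finset.sum_le_sum fun j _ => hf.lintegral_depthLayer_le hfm hU hm hc hp hA hP hR0 hR hτ hκ0
          hκθ hn.le hx₀ hxx₀ hdx₀ hδ hδ' hM hT hD j
    _ ≤ B₀ * ((1 - r)⁻¹ * ∑ k ∈ Finset.range (J + 1), K * Γ (depthBand U A τ R x k)) := by
        rw [← Finset.mul_sum]
        gcongr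
        exact ENNReal.sum_geometric_convolution_le r _ J
    _ ≤ B₀ * ((1 - r)⁻¹ * (K * (N * Γ {v | dist v x < 12 * A * R ∧
          τ ^ 2 / (4 * A) * (τ ^ J * R) ≤ Metric.infDist v Uᶜ}))) := by
        rw [← Finset.mul_sum]
        gcongr
        exact sum_measure_depthBand_le Γ hA hτ0 hτ1.le hR0 hN x J
    _ = _ := by ring

/-! ### From members of the domain to local functions. -/

theorem edist_rpow_eq_ofReal {p : ℝ} (hp : 0 ≤ p) (a b : ℝ) :
    edist a b ^ p = ENNReal.ofReal (|a - b| ^ p) := by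
  rw [edist_dist, Real.dist_eq, ENNReal.ofReal_rpow_of_nonneg (abs_nonneg _) hp]

/-- A function whose distance to some constant has a finite `p`-th moment on a set of finite measure
is in `L ^ p`, and replacing the constant by the average costs a factor `2 ^ p`. -/
theorem memLp_and_lintegral_edist_setAverage_le {X : Type*} [MeasurableSpace X] {m : Measure X}
    {p : ℝ} (hp : 1 ≤ p) {B : Set X} (h0 : m B ≠ 0) (htop : m B ≠ ∞) {f : X → ℝ}
    (hf : AEStronglyMeasurable f (m.restrict B)) {a : ℝ}
    (hfin : ∫⁻ y in B, edist (f y) a ^ p ∂m < ∞) :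
    MemLp f (ENNReal.ofReal p) (m.restrict B) ∧
      ∫⁻ y in B, edist (f y) (⨍ z in B, f z ∂m) ^ p ∂m ≤
        2 ^ p * ∫⁻ y in B, edist (f y) a ^ p ∂m := by
  have hp0 : 0 < p := by linarith
  have : IsFiniteMeasure (m.restrict B) := ⟨by simpa using htop.lt_top⟩
  have hsub : MemLp (fun y => f y - a) (ENNReal.ofReal p) (m.restrict B) := by
    refine ⟨hf.sub aestronglyMeasurable_const, ?_⟩
    rw [eLpNorm_lt_top_iff_lintegral_rpow_enorm_lt_top (by simpa using hp0) ENNReal.ofReal_ne_top,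
      ENNReal.toReal_ofReal hp0.le]
    simpa only [edist_eq_enorm_sub] using hfin
  have hmem : MemLp f (ENNReal.ofReal p) (m.restrict B) := by
    convert hsub.add (memLp_const a) using 1
    ext y
    simp
  refine ⟨hmem, ?_⟩
  have hint : IntegrableOn f B m := hmem.integrable (by simpa using hp)
  have hav := edist_setAverage_rpow_le hp h0 htop hint a
  set I := ∫⁻ y in B, edist (f y) a ^ p ∂m with hI
  calc ∫⁻ y in B, edist (f y) (⨍ z in B, f z ∂m) ^ p ∂m
      ≤ ∫⁻ y in B, 2 ^ (p - 1) * (edist (f y) a ^ p + I / m B) ∂m := by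
        refine lintegral_mono fun y => ?_
        calc edist (f y) (⨍ z in B, f z ∂m) ^ p
            ≤ (edist (f y) a + edist (⨍ z in B, f z ∂m) a) ^ p := by
              gcongr; exact edist_triangle_right _ _ _
          _ ≤ 2 ^ (p - 1) * (edist (f y) a ^ p + edist (⨍ z in B, f z ∂m) a ^ p) :=
              ENNReal.rpow_add_le_mul_rpow_add_rpow _ _ hp
          _ ≤ _ := by gcongr
    _ = 2 ^ (p - 1) * (I + I) := by
        rw [lintegral_const_mul' _ _ (ENNReal.rpow_ne_top_of_nonneg (by linarith) (by simp)),
          lintegral_add_right _ measurable_const]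
        rw [lintegral_const, Measure.restrict_apply_univ, ENNReal.div_mul_cancel h0 htop]
    _ = 2 ^ p * I := by
        rw [← two_mul, ← mul_assoc]
        congr 1
        conv_lhs => rw [← ENNReal.rpow_one 2, ← ENNReal.rpow_mul, one_mul]
        rw [← ENNReal.rpow_add _ _ (by simp) (by simp), sub_add_cancel]

theorem PEnergyStructure.Poincare.hasPoincareUpTo {X : Type*} [MetricSpace X] [MeasurableSpace X]
    [BorelSpace X] {m : Measure X} [IsLocallyFiniteMeasure m] {p c C P CΨ β₁ β₂ R : ℝ}
    {D : PEnergyStructure X m p} {Ψ : ℝ → ℝ} (h : D.Poincare Ψ C P) (hp : 1 ≤ p) (hC : 0 ≤ C)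
    (hΨ : IsScaleFunction Ψ CΨ β₁ β₂) (hm : VolumeDoubling m c) {r : ℝ} (hRr : R ≤ r)
    (w : D.domain) :
    HasPoincareUpTo m (w : X →ₘ[m] ℝ) (D.Γ w) p P R (ENNReal.ofReal (C * Ψ r)) where
  integrableOn_ball z ρ := by
    have : IsFiniteMeasure (m.restrict (Metric.ball z ρ)) :=
      ⟨by simpa using hm.measure_ball_lt_top z ρ⟩
    exact ((D.memLp w).restrict _).integrable (by simpa using hp)
  lintegral_le z ρ hρ hρR := by
    simp_rw [edist_rpow_eq_ofReal (by linarith : 0 ≤ p)]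
    refine (h z ρ hρ w).trans ?_
    have : Ψ ρ ≤ Ψ r := hΨ.strictMonoOn.monotoneOn hρ (hρ.trans_le (hρR.trans hRr))
      (hρR.trans hRr)
    gcongr

/-- The radius `r` may far exceed the diameter of `U`, so corkscrews need an effective scale: a
quarter of the largest distance from `x` within `B_U(x, r)`. Some `w` is more than `2 * R` from `x`,
so no point can be within `R` of both. -/
theorem exists_scale_of_ne {X : Type*} [MetricSpace X] {U : Set X} {x y : X} {r : ℝ}
    (hx : x ∈ U) (hy : y ∈ Metric.ball x r ∩ U) (hyx : y ≠ x) :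
    ∃ R, 0 < R ∧ 4 * R ≤ r ∧ (∀ z ∈ Metric.ball x r ∩ U, dist z x ≤ 4 * R) ∧
      (∃ w ∈ U, R ≤ dist x w) ∧ ∀ z ∈ U, ∃ w ∈ U, R ≤ dist z w := by
  set S := (fun z => dist z x) '' (Metric.ball x r ∩ U) with hS
  have hbdd : BddAbove S := ⟨r, by rintro _ ⟨z, hz, rfl⟩; exact le_of_lt hz.1⟩
  have hmem : ∀ z ∈ Metric.ball x r ∩ U, dist z x ≤ sSup S := fun z hz =>
    le_csSup hbdd (mem_image_of_mem _ hz)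
  have hpos : 0 < sSup S := (dist_pos.2 hyx).trans_le (hmem y hy)
  have hle : sSup S ≤ r := csSup_le ⟨_, mem_image_of_mem _ hy⟩ (by
    rintro _ ⟨z, hz, rfl⟩; exact le_of_lt hz.1)
  obtain ⟨_, ⟨w, hw, rfl⟩, hlt⟩ := exists_lt_of_lt_csSup ⟨_, mem_image_of_mem _ hy⟩
    (half_lt_self hpos)
  simp only at hlt
  refine ⟨sSup S / 4, by positivity, by linarith, fun z hz => by linarith [hmem z hz],
    ⟨w, hw.2, by rw [dist_comm]; linarith⟩, fun z _ => ?_⟩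
  by_contra! hcon
  have h1 := hcon x hx
  have h2 := hcon w hw.2
  have h3 := dist_triangle_left w x z
  linarith

/-- The interior estimate is applied to domain members agreeing with `u` on an exhaustion. The
comparison constant is the same at every stage because the central ball lies in every exhausting
set. -/
theorem exists_lintegral_edist_const_le (p c A P C : ℝ) (hp : 1 ≤ p) (hc : 1 ≤ c)
    (hA : 1 ≤ A) (hP : 1 ≤ P) (hC : 0 ≤ C) : ∃ B : ℝ≥0∞, B ≠ ∞ ∧
      ∀ (X : Type u) [MetricSpace X] [CompleteSpace X] [MeasurableSpace X] [BorelSpace X]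
        [SecondCountableTopology X] (m : Measure X) [IsLocallyFiniteMeasure m]
        [m.IsOpenPosMeasure] (D : PEnergyStructure X m p) (Ψ : ℝ → ℝ) (CΨ β₁ β₂ : ℝ),
        IsScaleFunction Ψ CΨ β₁ β₂ → VolumeDoubling m c → D.Poincare Ψ C P →
        ∀ U : Set X, IsUniformDomain A U → ∀ x ∈ U, ∀ r : ℝ, 0 < r →
        (∃ y ∈ Metric.ball x r ∩ U, y ≠ x) →
        ∀ u : X →ₘ[m.restrict (Metric.ball x (4 * A * r) ∩ U)] ℝ,
          D.MemLoc (Metric.ball x (4 * A * r) ∩ U) u →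
          ∃ a : ℝ, ∫⁻ y in Metric.ball x r ∩ U, edist (u y) a ^ p ∂m ≤
            B * (ENNReal.ofReal (C * Ψ r) *
              D.localEnergy (Metric.ball x (4 * A * r) ∩ U) u (Metric.ball x (4 * A * r) ∩ U)) := by
  obtain ⟨τ, κ, B, hτ0, hτ, hκ0, hκτ, hB, hmain⟩ :=
    exists_lintegral_edist_central_average_le.{u} p c A P hp hc hA hP
  refine ⟨B, hB, ?_⟩
  intro X _ _ _ _ _ m _ _ D Ψ CΨ β₁ β₂ hΨ hm hD U hU x hx r hr ⟨y, hy, hyx⟩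
  have hA0 : 0 < A := by linarith
  have hτ8 : τ ≤ 1 / 8 := by
    rw [hτ]; gcongr; linarith
  have hτ1 : τ ≤ 1 := by linarith
  obtain ⟨R, hR0, hRr, hball, ⟨w₀, hw₀, hRw₀⟩, hfar⟩ := exists_scale_of_ne hx hy hyx
  obtain ⟨x₀, hx₀, hxx₀, hdx₀⟩ := hU.exists_corkscrew hA hx hw₀ hR0 hRw₀
  have hproper := hm.properSpace
  have hAR : R ≤ A * R := le_mul_of_one_le_left hR0.le hA
  have hARr : A * (4 * R) ≤ A * r := by gcongr
  set V := Metric.ball x (4 * A * r) ∩ U with hV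
  intro u hu
  set σ : ℝ := τ ^ 2 / (4 * A) with hσ
  have hσ0 : 0 < σ := by positivity
  have hστ : σ ≤ τ := by
    rw [hσ, sq]
    refine (div_le_self (by positivity) (by linarith)).trans (mul_le_of_le_one_left hτ0.le hτ1)
  have hs : ∀ J : ℕ, 0 < τ ^ J * R := fun J => by positivity
  have hsR : ∀ J : ℕ, τ ^ J * R ≤ R := fun J =>
    mul_le_of_le_one_left hR0.le (pow_le_one₀ hτ0.le hτ1)
  -- Half the depth threshold of the energy set, so that this open set contains it while its closure
  -- stays in `V`; horizontally, `12 * A * R ≤ 3 * A * r < 4 * A * r`.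
  set O : ℕ → Set X := fun J =>
    {v | dist v x < 12 * A * R ∧ σ * (τ ^ J * R) / 2 < Metric.infDist v Uᶜ} with hO
  have hd : Continuous fun v : X => Metric.infDist v Uᶜ := Metric.continuous_infDist_pt _
  have hOrel : ∀ J, IsRelCompactOpenIn (O J) V := fun J => by
    have hcl : closure (O J) ⊆
        {v | dist v x ≤ 12 * A * R ∧ σ * (τ ^ J * R) / 2 ≤ Metric.infDist v Uᶜ} := by
      refine closure_minimal (fun v hv => ⟨hv.1.le, hv.2.le⟩) ?_
      exact (isClosed_le (continuous_id.dist continuous_const) continuous_const).inter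
        (isClosed_le continuous_const hd)
    refine ⟨(isOpen_lt (continuous_id.dist continuous_const) continuous_const).inter
      (isOpen_lt continuous_const hd), ?_, fun v hv => ?_⟩
    · exact (isCompact_closedBall x (12 * A * R)).of_isClosed_subset isClosed_closure
        fun v hv => (hcl hv).1
    · have hv' := hcl hv
      refine ⟨?_, mem_of_infDist_compl_pos (lt_of_lt_of_le ?_ hv'.2)⟩
      · rw [Metric.mem_ball]
        have := hv'.1
        have : 0 < A * r := mul_pos hA0 hr
        linarith
      · have := hs J
        positivity
  set E : ℕ → Set X := fun J =>
    {y | y ∈ U ∧ dist y x ≤ 4 * R ∧ τ * (τ ^ J * R) ≤ Metric.infDist y Uᶜ} with hE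
  have hEO : ∀ J, E J ⊆ O J := fun J v hv => by
    have h1 := hv.2.1
    have h2 := hv.2.2
    have h3 : σ * (τ ^ J * R) ≤ τ * (τ ^ J * R) := mul_le_mul_of_nonneg_right hστ (hs J).le
    have h4 : 0 < σ * (τ ^ J * R) := mul_pos hσ0 (hs J)
    constructor <;> linarith
  have hx₀O : ∀ J, Metric.ball x₀ (κ * R) ⊆ O J := fun J v hv => by
    rw [Metric.mem_ball] at hv
    have h1 := dist_triangle v x₀ x
    rw [dist_comm x₀ x] at h1
    have h2 := Metric.infDist_le_infDist_add_dist (s := Uᶜ) (x := x₀) (y := v)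
    rw [dist_comm x₀ v] at h2
    have h3 : κ * R ≤ τ * R := by gcongr
    have h4 : R / (2 * A) = 4 * (τ * R) := by rw [hτ]; field_simp; norm_num
    have h5 : σ * (τ ^ J * R) ≤ τ * R := mul_le_mul hστ (hsR J) (hs J).le hτ0.le
    have h6 : 0 < τ * R := mul_pos hτ0 hR0
    have h7 : τ * R ≤ R := mul_le_of_le_one_left hR0.le hτ1
    constructor <;> linarith
  set a := ⨍ z in Metric.ball x₀ (κ * R), u z ∂m with ha
  refine ⟨a, ?_⟩
  have hJ : ∀ J, ∫⁻ y in E J, edist (u y) a ^ p ∂m ≤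
      B * (ENNReal.ofReal (C * Ψ r) * D.localEnergy V u V) := fun J => by
    obtain ⟨w, hw⟩ := hu (O J) (hOrel J)
    have hfin := D.finite_Γ w
    have hwa : ⨍ z in Metric.ball x₀ (κ * R), (w : X →ₘ[m] ℝ) z ∂m = a :=
      average_congr (ae_restrict_of_ae_restrict_of_subset (hx₀O J) hw)
    have h1 := hmain X m (D.Γ w) (w : X →ₘ[m] ℝ) R (ENNReal.ofReal (C * Ψ r)) U x x₀ J
      (AEEqFun.measurable _) (hD.hasPoincareUpTo hp hC hΨ hm (by linarith) w) hU hm hR0 hfar hx₀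
      hxx₀ hdx₀
    rw [hwa] at h1
    calc ∫⁻ y in E J, edist (u y) a ^ p ∂m
        = ∫⁻ y in E J, edist ((w : X →ₘ[m] ℝ) y) a ^ p ∂m := by
          refine lintegral_congr_ae ?_
          filter_upwards [ae_restrict_of_ae_restrict_of_subset (hEO J) hw] with v hv
          rw [hv]
      _ ≤ _ := h1
      _ ≤ _ := by
          gcongr
          refine le_trans (measure_mono fun v hv => ?_)
            (le_iSup₂_of_le (O J) (hOrel J) (le_iSup₂_of_le w hw le_rfl))
          have hvO : v ∈ O J := ⟨hv.1, by
            have := mul_pos hσ0 (hs J)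
            linarith [hv.2]⟩
          exact ⟨(hOrel J).2.2 (subset_closure hvO), hvO⟩
  have hmono : Monotone E := fun i j hij v hv => ⟨hv.1, hv.2.1, le_trans (by
    have := pow_le_pow_of_le_one hτ0.le hτ1 hij
    gcongr) hv.2.2⟩
  have hcover : Metric.ball x r ∩ U ⊆ ⋃ J, E J := fun v hv => by
    have hdv := hU.infDist_compl_pos hv.2
    obtain ⟨J, hJ⟩ := exists_pow_lt_of_lt_one (y := τ) (div_pos hdv hR0) (by linarith)
    refine mem_iUnion.2 ⟨J, hv.2, hball v hv, ?_⟩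
    rw [lt_div_iff₀ hR0] at hJ
    exact (mul_le_of_le_one_left (hs J).le hτ1).trans hJ.le
  refine (lintegral_mono_set hcover).trans ?_
  -- Continuity of the integral along the increasing sets `E J` lets the depth cutoff vanish.
  rw [setLIntegral_iUnion_of_directed _ hmono.directed_le]
  exact iSup_le hJ

theorem mainTheorem6 (p cD A CΨ β₂ CP AP : ℝ) (hp : 1 < p) (hcD : 1 ≤ cD) (hA : 1 ≤ A)
    (hCΨ : 1 ≤ CΨ) (hβ₂ : 0 < β₂) (hCP : 0 < CP) (hAP : 1 ≤ AP) :
    ∃ AU CU : ℝ, 1 ≤ AU ∧ 1 ≤ CU ∧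
      ∀ (X : Type*) [MetricSpace X] [LocallyCompactSpace X] [TopologicalSpace.SeparableSpace X]
        [CompleteSpace X] [Nontrivial X] [MeasurableSpace X] [BorelSpace X]
        (m : Measure X) [IsLocallyFiniteMeasure m] [m.IsOpenPosMeasure]
        (D : PEnergyStructure X m p) (Ψ : ℝ → ℝ) (β₁ : ℝ),
        0 < β₁ → IsScaleFunction Ψ CΨ β₁ β₂ → VolumeDoubling m cD → D.Poincare Ψ CP AP →
        ∀ U : Set X, IsUniformDomain A U →
        ∀ x ∈ U, ∀ r : ℝ, 0 < r →
        ∀ u : X →ₘ[m.restrict (Metric.ball x (AU * r) ∩ U)] ℝ,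
          D.MemLoc (Metric.ball x (AU * r) ∩ U) u →
          (D.localEnergy (Metric.ball x (AU * r) ∩ U) u (Metric.ball x (AU * r) ∩ U) < ∞ →
            MemLp u (ENNReal.ofReal p) (m.restrict (Metric.ball x r ∩ U))) ∧
          ∫⁻ y in Metric.ball x r ∩ U,
              ENNReal.ofReal (|u y - ⨍ z in Metric.ball x r ∩ U, u z ∂m| ^ p) ∂m
            ≤ ENNReal.ofReal (CU * Ψ r) *
              D.localEnergy (Metric.ball x (AU * r) ∩ U) u (Metric.ball x (AU * r) ∩ U) := by
  obtain ⟨B, hB, hmain⟩ := exists_lintegral_edist_const_le p cD A AP CP hp.le hcD hA hAP hCP.le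
  have hp0 : 0 < p := by linarith
  have hB2 : 2 ^ p * B ≠ ∞ :=
    ENNReal.mul_ne_top (ENNReal.rpow_ne_top_of_nonneg hp0.le (by simp)) hB
  -- The factor `2 ^ p` pays for replacing the central average by the average over `B_U(x, r)`.
  refine ⟨4 * A, max 1 ((2 ^ p * B).toReal * CP), by linarith, le_max_left _ _, ?_⟩
  intro X _ _ _ _ _ _ _ m _ _ D Ψ β₁ hβ₁ hΨ hm hD U hU x hx r hr
  have : SecondCountableTopology X := UniformSpace.secondCountable_of_separable X
  set V := Metric.ball x (4 * A * r) ∩ U with hV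
  set W := Metric.ball x r ∩ U with hW
  intro u hu
  set CU := max 1 ((2 ^ p * B).toReal * CP) with hCU
  have hΨr : 0 < Ψ r := hΨ.bijOn.mapsTo hr
  have hW0 : m W ≠ 0 := ((Metric.isOpen_ball.inter hU.isOpen).measure_pos m
    ⟨x, Metric.mem_ball_self hr, hx⟩).ne'
  have hWtop : m W ≠ ∞ :=
    ((measure_mono inter_subset_left).trans_lt (hm.measure_ball_lt_top x r)).ne
  have : IsFiniteMeasure (m.restrict W) := ⟨by simpa using hWtop.lt_top⟩
  simp_rw [← edist_rpow_eq_ofReal hp0.le]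
  by_cases hex : ∃ y ∈ W, y ≠ x
  · obtain ⟨a, ha⟩ := hmain X m D Ψ CΨ β₁ β₂ hΨ hm hD U hU x hx r hr hex u hu
    rcases eq_or_ne (D.localEnergy V u V) ∞ with hE | hE
    · refine ⟨fun h => absurd hE h.ne, ?_⟩
      rw [hE, ENNReal.mul_top]
      · exact le_top
      · exact (ENNReal.ofReal_pos.2 (by positivity)).ne'
    · have hWV : W ⊆ V := inter_subset_inter_left _ (Metric.ball_subset_ball (by nlinarith))
      have hum : AEStronglyMeasurable u (m.restrict W) :=
        u.aestronglyMeasurable.mono_measure (Measure.restrict_mono hWV le_rfl)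
      obtain ⟨hLp, hle⟩ := memLp_and_lintegral_edist_setAverage_le hp.le hW0 hWtop hum
        (ha.trans_lt (ENNReal.mul_lt_top hB.lt_top
          (ENNReal.mul_lt_top ENNReal.ofReal_lt_top hE.lt_top)))
      refine ⟨fun _ => hLp, hle.trans ?_⟩
      calc _ ≤ 2 ^ p * (B * (ENNReal.ofReal (CP * Ψ r) * D.localEnergy V u V)) := by gcongr
        _ = ENNReal.ofReal ((2 ^ p * B).toReal * CP * Ψ r) * D.localEnergy V u V := by
          rw [mul_assoc (2 ^ p * B).toReal, ENNReal.ofReal_mul ENNReal.toReal_nonneg,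
            ENNReal.ofReal_toReal hB2]
          ring
        _ ≤ _ := by
          gcongr
          exact le_max_right _ _
  -- If `B_U(x, r)` is a single point there is no positive scale `R`, but `u` is constant there and
  -- the left side vanishes.
  · have hWx : W = {x} := by
      push Not at hex
      exact Subset.antisymm (fun y hy => hex y hy) (by
        rintro _ rfl
        exact ⟨Metric.mem_ball_self hr, hx⟩)
    have hconst : (u : X → ℝ) =ᵐ[m.restrict W] fun _ => u x := by
      refine (ae_restrict_iff' (by rw [hWx]; exact measurableSet_singleton x)).2 ?_
      refine Eventually.of_forall fun y hy => ?_
      rw [hWx] at hy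
      rw [mem_singleton_iff.1 hy]
    have hav : ⨍ z in W, u z ∂m = u x := by
      rw [average_congr hconst, setAverage_const hW0 hWtop]
    refine ⟨fun _ => (memLp_congr_ae hconst).2 (memLp_const _), ?_⟩
    rw [hav]
    have h0 : ∫⁻ y in W, edist (u y) (u x) ^ p ∂m = 0 := by
      rw [lintegral_congr_ae (g := fun _ => 0)]
      · simp
      · filter_upwards [hconst] with y hy
        rw [hy, edist_self, ENNReal.zero_rpow_of_pos hp0]
    rw [h0]
    exact zero_le
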